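/- Let $n_{\mathrm T},n_{\mathrm R}\ge 1$ and $K\ge 0$ be integers. For an $n_{\mathrm R}\times n_{\mathrm T}$ complex matrix $\mathbf H$ and $N_0>0$, let $\mathbf y=\mathbf H\mathbf x+\mathbf n$, where $\mathbf x\sim\mathcal{CN}(\mathbf 0,\mathbf I_{n_{\mathrm T}})$ and $\mathbf n\sim\mathcal{CN}(\mathbf 0,N_0\mathbf I_{n_{\mathrm R}})$ are independent circularly symmetric complex Gaussian vectors. A channel shortening (CS) receiver of memory $K$ is a pair $(\mathbf H_{\mathrm r},\mathbf G_{\mathrm r})$ of an arbitrary $n_{\mathrm T}\times n_{\mathrm R}$ complex matrix $\mathbf H_{\mathrm r}$ and a Hermitian $n_{\mathrm T}\times n_{\mathrm T}$ matrix $\mathbf G_{\mathrm r}$ with $(\mathbf G_{\mathrm r})_{k\ell}=0$ for $|k-\ell|>K$. With $$\tilde T(\mathbf y|\mathbf x)=\exp\left(2\,\mathrm{Re}\{\mathbf x^{\mathrm H}\mathbf H_{\mathrm r}\mathbf y\}-\mathbf x^{\mathrm H}\mathbf G_{\mathrm r}\mathbf x\right),\qquad \tilde T(\mathbf y)=\int\tilde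 T(\mathbf y|\mathbf x)\,p_{\mathbf X}(\mathbf x)\,\mathrm d\mathbf x,$$ its generalized mutual information is $$I_{\mathrm{GMI}}(\mathbf H_{\mathrm r},\mathbf G_{\mathrm r})=-\mathbb E[\log\tilde T(\mathbf y)]+\mathbb E[\log\tilde T(\mathbf y|\mathbf x)],$$ the expectations being over the joint law of $(\mathbf x,\mathbf y)$ for fixed $\mathbf H$, with value $-\infty$ if $\tilde T(\mathbf y)$ is infinite. For $\mathrm{snr}>0$ put $N_0=n_{\mathrm T}/\mathrm{snr}$. Then for every $\mathbf H$ the maximum $I_{\mathrm{GMI}}(\mathrm{snr})=I_{\mathrm{GMI}}(\mathrm{snr};\mathbf H)$ of $I_{\mathrm{GMI}}(\mathbf H_{\mathrm r},\mathbf G_{\mathrm r})$ over all CS receivers of memory $K$ is attained and finite (this is the rate of the optimized CS detector with memory $K$). If $\mathbf H$ is random with independent circularly symmetric complex Gaussian entries of mean zero and unit variance, then $\mathbb E_{\mathbf H}[I_{\mathrm{GMI}}(\mathrm{snr})]$ is finite for every $\mathrm{snr}>0$, and the high-SNR slope of the ergodic rate is $$S_\infty^{\mathrm{CS}}=\lim_{\mathrm{snr}\to\infty}\frac{\mathbb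 E_{\mathbf H}[I_{\mathrm{GMI}}(\mathrm{snr})]}{\log(\mathrm{snr})}=\begin{cases}n_{\mathrm T},& n_{\mathrm R}\ge n_{\mathrm T},\\ n_{\mathrm R},& n_{\mathrm R}<n_{\mathrm T}\le n_{\mathrm R}+K,\\ 0,&\text{otherwise.}\end{cases}$$ -/

import Mathlib

open MeasureTheory ProbabilityTheory Filter Topology
open scoped NNReal Matrix

noncomputable section

namespace ChannelShortening

/-- The circularly symmetric complex Gaussian law with mean `0` and variance `v`
(so `E|z|² = v`): real and imaginary part are independent real Gaussians of variance `v / 2`. -/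
def complexGaussian (v : ℝ≥0) : Measure ℂ :=
  ((gaussianReal 0 (v / 2)).prod (gaussianReal 0 (v / 2))).map
    Complex.measurableEquivRealProd.symm

/-- The circularly symmetric complex Gaussian law on `ℂⁿ` with mean `0` and covariance `v • I`. -/
def complexGaussianVec (n : ℕ) (v : ℝ≥0) : Measure (Fin n → ℂ) :=
  Measure.pi fun _ => complexGaussian v

/-- The law of the array of entries of an `nR × nT` matrix with independent circularly symmetric complex Gaussian
entries of mean `0` and variance `1`. -/
def channelMatrixLaw (nR nT : ℕ) : Measure (Fin nR → Fin nT → ℂ) :=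
  Measure.pi fun _ => Measure.pi fun _ => complexGaussian 1

section Fixed

variable {nT nR : ℕ}

/-- The joint law of `(x, y)`, where `y = H x + n`, the input `x` has law `CN(0, I)`, and the noise
`n` is independent of `x` with law `CN(0, N₀ I)`. -/
def inputOutputLaw (H : Matrix (Fin nR) (Fin nT) ℂ) (N₀ : ℝ≥0) :
    Measure ((Fin nT → ℂ) × (Fin nR → ℂ)) :=
  ((complexGaussianVec nT 1).prod (complexGaussianVec nR N₀)).map
    fun p => (p.1, H *ᵥ p.1 + p.2)

variable (nT nR) in
/-- The parameters of a channel shortening receiver of memory `K`: an arbitrary front-end matrix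
`Hr` and a Hermitian matrix `Gr` that vanishes off the center `2 K + 1` diagonals. -/
structure Receiver (K : ℕ) where
  Hr : Matrix (Fin nT) (Fin nR) ℂ
  Gr : Matrix (Fin nT) (Fin nT) ℂ
  isHermitian : Gr.IsHermitian
  banded : ∀ i j : Fin nT, (K : ℤ) < |(i : ℤ) - (j : ℤ)| → Gr i j = 0

namespace Receiver

variable {K : ℕ} (r : Receiver nT nR K)

/-- The mismatched metric `exp (2 Re (xᴴ Hr y) - xᴴ Gr x)`; the quadratic form is real
because `Gr` is Hermitian. -/
def metric (y : Fin nR → ℂ) (x : Fin nT → ℂ) : ℝ :=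
  Real.exp (2 * (star x ⬝ᵥ (r.Hr *ᵥ y)).re - (star x ⬝ᵥ (r.Gr *ᵥ x)).re)

/-- The metric averaged over the input law. -/
def outputMetric (y : Fin nR → ℂ) : ℝ :=
  ∫ x, r.metric y x ∂complexGaussianVec nT 1

open Classical in
/-- The generalized mutual information, in nats,
`- E[log T(y)] + E[log T(y|x)]`, where `T(y|x)` is the metric and `T(y)` its average over the input.
It is `-∞` for those receivers for which the integral of a positive function that defines
`T(y)` diverges. -/
def gmi (H : Matrix (Fin nR) (Fin nT) ℂ) (N₀ : ℝ≥0) : EReal :=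
  if ∀ y, Integrable (r.metric y) (complexGaussianVec nT 1) then
    ((-(∫ p, Real.log (r.outputMetric p.2) ∂inputOutputLaw H N₀)
      + ∫ p, Real.log (r.metric p.2 p.1) ∂inputOutputLaw H N₀ : ℝ) : EReal)
  else ⊥

end Receiver

/-- The rate of the optimized receiver of memory `K` for the channel `H` and noise density `N₀`:
the generalized mutual information, optimized over all receivers of memory `K`. -/
def optimizedRate (K : ℕ) (H : Matrix (Fin nR) (Fin nT) ℂ) (N₀ : ℝ≥0) : ℝ :=
  (⨆ r : Receiver nT nR K, r.gmi H N₀).toReal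

end Fixed

/-- The noise density at which `1 / N₀ = snr / nT`. -/
def noiseDensity (nT : ℕ) (snr : ℝ) : ℝ≥0 := Real.toNNReal (nT / snr)

/-- The expectation of the optimized rate over the channel law. -/
def ergodicRate (nT nR K : ℕ) (snr : ℝ) : ℝ :=
  ∫ h, optimizedRate K (Matrix.of h) (noiseDensity nT snr)
      ∂channelMatrixLaw nR nT

end ChannelShortening

end

namespace ChannelShortening

open scoped ComplexOrder ENNReal

/-! Write `M = 1 + Gr`, `Y = H Hᴴ + N₀` and `E = 1 - Hᴴ Y⁻¹ H`. The Gaussian integral defining the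
output metric is explicit when `M` is positive definite and diverges otherwise. Taking expectations
and completing the square in `Hr` turns the GMI into `log det M - tr (M E) + nT` minus a nonnegative
term that vanishes for `Hr = M Hᴴ Y⁻¹` (`Receiver.gmiReal_eq`).

A banded positive definite `M` factors as `U Uᴴ` with `U` lower triangular and column `k` supported
in the window `{k, …, k + K}` (`exists_window_decomposition`); conversely such a `U` with nonzero
diagonal gives an admissible `M`. Since `det M` is the product of the `|U k k|²` and `tr (M E)` is
the sum of `uᴴ E u` over the columns, the optimization splits into one problem per column: maximize
`log |u k|² - uᴴ E u + 1` over vectors `u` in window `k` with `u k ≠ 0`. Each maximum is attained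
(`exists_isMaxOn_columnRate`).

With `s = Y⁻¹ H u` one has `uᴴ E u = ‖u - Hᴴ s‖² + N₀ ‖s‖²`, so the error power can be of order `N₀`
only near the range of `Hᴴ`. No column rate exceeds `log snr + O(1)`. If `k ≥ nR` or `nT > nR + K`,
there are `nR` coordinates outside the window; generically no nonzero `Hᴴ s` vanishes on them, and
the rate stays bounded (`exists_columnRate_le_of_window_small`). Otherwise some `Hᴴ s` lies in the
window with nonzero pivot, and the rate is `log snr + O(1)`
(`exists_le_columnRate_of_window_large`). The slope counts the columns of the second kind.

To average over the channel, the `O(1)` terms must be integrable and free of `snr`. They are built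
from `log (1 + f)` with `f` of polynomial growth in the entries and from `log |det|` of a minor; the
latter is integrable because a nonzero polynomial in Gaussian variables has integrable logarithm
(`integrable_log_norm_entryEval`). -/

instance isProbabilityMeasure_complexGaussian (v : ℝ≥0) :
    IsProbabilityMeasure (complexGaussian v) :=
  Measure.isProbabilityMeasure_map (MeasurableEquiv.measurable _).aemeasurable

instance isProbabilityMeasure_complexGaussianVec (n : ℕ) (v : ℝ≥0) :
    IsProbabilityMeasure (complexGaussianVec n v) := by
  unfold complexGaussianVec; infer_instance

instance isProbabilityMeasure_channelMatrixLaw (nR nT : ℕ) :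
    IsProbabilityMeasure (channelMatrixLaw nR nT) := by
  unfold channelMatrixLaw; infer_instance

/-! ### Gaussian integrals of exponentials of quadratic forms -/

lemma measurableEquivRealProd_symm_apply' (p : ℝ × ℝ) :
    Complex.measurableEquivRealProd.symm p = ⟨p.1, p.2⟩ := by
  apply Complex.measurableEquivRealProd.injective
  simp [Complex.measurableEquivRealProd]

lemma charFun_complexGaussian (v : ℝ≥0) (t : ℂ) :
    charFun (complexGaussian v) t = Complex.exp (-(v * ‖t‖ ^ 2 / 4 : ℝ)) := by
  have key : ∀ p : ℝ × ℝ, Complex.exp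
      (((inner ℝ (Complex.measurableEquivRealProd.symm p) t : ℝ) : ℂ) * Complex.I) =
      Complex.exp ((inner ℝ p.1 t.re : ℝ) * Complex.I) *
      Complex.exp ((inner ℝ p.2 t.im : ℝ) * Complex.I) := by
    intro p
    rw [← Complex.exp_add, measurableEquivRealProd_symm_apply', Complex.inner]
    congr 1
    simp
    ring
  rw [charFun_apply, complexGaussian, integral_map_equiv]
  simp_rw [key]
  rw [integral_prod_mul (fun x : ℝ => Complex.exp ((inner ℝ x t.re : ℝ) * Complex.I))
    (fun x : ℝ => Complex.exp ((inner ℝ x t.im : ℝ) * Complex.I)), ← charFun_apply,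
    ← charFun_apply, charFun_gaussianReal, charFun_gaussianReal, ← Complex.exp_add]
  congr 1
  rw [← Complex.normSq_eq_norm_sq, Complex.normSq_apply]
  push_cast
  ring

lemma dotProduct_star_conjTranspose_mulVec {m n : Type*} [Fintype m] [Fintype n]
    (A : Matrix m n ℂ) (x : n → ℂ) (t : m → ℂ) :
    star (A *ᵥ x) ⬝ᵥ t = star x ⬝ᵥ (Aᴴ *ᵥ t) := by
  rw [Matrix.star_mulVec, Matrix.dotProduct_mulVec]

lemma re_star_dotProduct_self {m : Type*} [Fintype m] (x : m → ℂ) :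
    (star x ⬝ᵥ x).re = ∑ i, ‖x i‖ ^ 2 := by
  simp [dotProduct, ← Complex.normSq_eq_norm_sq, Complex.normSq_apply]

/-- The characteristic function depends only on the Euclidean norm of its argument. This unitary
invariance is what later allows `Gr` to be diagonalized inside the integral. -/
lemma map_mulVec_complexGaussianVec (n : ℕ) (v : ℝ≥0) (V : Matrix (Fin n) (Fin n) ℂ)
    (hV : V * Vᴴ = 1) :
    (complexGaussianVec n v).map (fun x => V *ᵥ x) = complexGaussianVec n v := by
  have hmeas : Measurable (fun x : Fin n → ℂ => V *ᵥ x) :=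
    (Continuous.matrix_mulVec continuous_const continuous_id).measurable
  have hinner : ∀ x t : PiLp 2 (fun _ : Fin n => ℂ), (inner ℝ x t : ℝ) = (star x.ofLp ⬝ᵥ t.ofLp).re := by
    intro x t
    rw [PiLp.inner_apply]
    simp [dotProduct, Complex.inner, mul_comm]
  have hpi : ∀ t : PiLp 2 (fun _ : Fin n => ℂ),
      charFun ((complexGaussianVec n v).map (WithLp.toLp 2)) t =
        Complex.exp (-(v * (star t.ofLp ⬝ᵥ t.ofLp).re / 4 : ℝ)) := by
    intro t
    rw [complexGaussianVec, charFun_pi]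
    simp_rw [charFun_complexGaussian]
    rw [← Complex.exp_sum, re_star_dotProduct_self]
    congr 1
    push_cast
    rw [Finset.sum_neg_distrib, ← Finset.sum_div, ← Finset.mul_sum]
  apply (MeasurableEquiv.toLp 2 (Fin n → ℂ)).map_measurableEquiv_injective
  apply Measure.ext_of_charFun (E := PiLp 2 (fun _ : Fin n => ℂ))
  ext t
  have h1 : charFun (((complexGaussianVec n v).map (fun x => V *ᵥ x)).map (WithLp.toLp 2)) t
      = charFun ((complexGaussianVec n v).map (WithLp.toLp 2)) (WithLp.toLp 2 (Vᴴ *ᵥ t.ofLp)) := by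
    rw [charFun_apply, charFun_apply, ← MeasurableEquiv.coe_toLp, integral_map_equiv,
      integral_map_equiv, integral_map hmeas.aemeasurable]
    · congr 1
      ext x
      rw [hinner, hinner]
      simp only [MeasurableEquiv.coe_toLp]
      rw [dotProduct_star_conjTranspose_mulVec]
    · apply Continuous.aestronglyMeasurable
      simp only [MeasurableEquiv.coe_toLp]
      fun_prop
  rw [MeasurableEquiv.coe_toLp, h1, hpi, hpi]
  congr 4
  simp only
  rw [dotProduct_star_conjTranspose_mulVec, Matrix.mulVec_mulVec, Matrix.conjTranspose_conjTranspose,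
    hV, Matrix.one_mulVec]

lemma lintegral_exp_quadratic_gaussianReal (b l : ℝ) :
    ∫⁻ t, ENNReal.ofReal (Real.exp (2 * b * t - l * t ^ 2)) ∂gaussianReal 0 (1 / 2) =
      if 0 < 1 + l then ENNReal.ofReal (Real.exp (b ^ 2 / (1 + l)) / √(1 + l)) else ⊤ := by
  have hne : (1 / 2 : ℝ≥0) ≠ 0 := by norm_num
  have hpdf : ∀ t : ℝ, gaussianPDFReal 0 (1 / 2) t = (√Real.pi)⁻¹ * Real.exp (-t ^ 2) := by
    intro t
    rw [gaussianPDFReal]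
    congr 2
    · congr 1
      push_cast; ring
    · push_cast; ring
  rw [gaussianReal_of_var_ne_zero _ hne,
    lintegral_withDensity_eq_lintegral_mul _ (measurable_gaussianPDF _ _) (by fun_prop)]
  have hmul : ∀ t : ℝ, (gaussianPDF 0 (1 / 2) * fun t => ENNReal.ofReal
      (Real.exp (2 * b * t - l * t ^ 2))) t =
      ENNReal.ofReal ((√Real.pi)⁻¹ * Real.exp (2 * b * t - (1 + l) * t ^ 2)) := by
    intro t
    rw [Pi.mul_apply, gaussianPDF, ← ENNReal.ofReal_mul (gaussianPDFReal_nonneg _ _ _), hpdf,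
      mul_assoc, ← Real.exp_add]
    congr 3
    ring
  simp_rw [hmul]
  split_ifs with h
  · set s := 1 + l with hs
    have hv : (Real.toNNReal (1 / (2 * s))) ≠ 0 := by
      simp only [ne_eq, Real.toNNReal_eq_zero, not_le]; positivity
    have hco : ((Real.toNNReal (1 / (2 * s)) : ℝ≥0) : ℝ) = 1 / (2 * s) :=
      Real.coe_toNNReal _ (by positivity)
    have : ∀ t : ℝ, ENNReal.ofReal ((√Real.pi)⁻¹ * Real.exp (2 * b * t - s * t ^ 2)) =
        ENNReal.ofReal (Real.exp (b ^ 2 / s) / √s) *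
          ENNReal.ofReal (gaussianPDFReal (b / s) (Real.toNNReal (1 / (2 * s))) t) := by
      intro t
      rw [← ENNReal.ofReal_mul (by positivity), gaussianPDFReal, hco]
      congr 1
      have e1 : √(2 * Real.pi * (1 / (2 * s))) = √Real.pi / √s := by
        rw [← Real.sqrt_div' _ h.le]; congr 1; field_simp
      have e2 : 2 * b * t - s * t ^ 2 = b ^ 2 / s + -(t - b / s) ^ 2 / (2 * (1 / (2 * s))) := by
        field_simp; ring
      rw [e1, e2, Real.exp_add]
      have : √s ≠ 0 := by positivity
      have : √Real.pi ≠ 0 := by positivity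
      field_simp
    simp_rw [this]
    rw [lintegral_const_mul _ (by fun_prop), lintegral_gaussianPDFReal_eq_one _ hv, mul_one]
  · by_contra hfin
    have hint : Integrable (fun t : ℝ => (√Real.pi)⁻¹ * Real.exp (2 * b * t - (1 + l) * t ^ 2)) := by
      refine ⟨by fun_prop, ?_⟩
      rw [hasFiniteIntegral_iff_ofReal (ae_of_all _ fun t => by positivity)]
      exact lt_top_iff_ne_top.2 hfin
    -- Adding the reflected integrand removes the sign of the linear term: one of the two
    -- exponentials is always at least `1`, so integrability would make a positive constant
    -- integrable on the line.
    have hneg := hint.comp_neg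
    have hsum := hint.add hneg
    have hconst : Integrable (fun _ : ℝ => (√Real.pi)⁻¹) := by
      refine hsum.mono' (by fun_prop) (ae_of_all _ fun t => ?_)
      have hpi : 0 < (√Real.pi)⁻¹ := by positivity
      rw [Real.norm_of_nonneg hpi.le]
      have h2 : 0 ≤ -(1 + l) * t ^ 2 := mul_nonneg (by linarith) (sq_nonneg t)
      simp only [Pi.add_apply]
      rw [← mul_add]
      refine le_mul_of_one_le_right hpi.le ?_
      rcases le_total 0 (b * t) with h3 | h3
      · have : 1 ≤ Real.exp (2 * b * t - (1 + l) * t ^ 2) := Real.one_le_exp (by linarith)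
        have := Real.exp_pos (2 * b * -t - (1 + l) * (-t) ^ 2)
        linarith
      · have : 1 ≤ Real.exp (2 * b * -t - (1 + l) * (-t) ^ 2) :=
          Real.one_le_exp (by rw [neg_sq]; linarith)
        have := Real.exp_pos (2 * b * t - (1 + l) * t ^ 2)
        linarith
    rw [integrable_const_iff] at hconst
    rcases hconst with h0 | h0
    · have : 0 < (√Real.pi)⁻¹ := by positivity
      exact this.ne' h0
    · have := h0.measure_univ_lt_top
      simp at this

lemma lintegral_exp_quadratic_complexGaussian (b : ℂ) (l : ℝ) :
    ∫⁻ z, ENNReal.ofReal (Real.exp (2 * (star z * b).re - l * ‖z‖ ^ 2)) ∂complexGaussian 1 =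
      if 0 < 1 + l then ENNReal.ofReal (Real.exp (‖b‖ ^ 2 / (1 + l)) / (1 + l)) else ⊤ := by
  rw [complexGaussian, lintegral_map_equiv]
  have key : ∀ p : ℝ × ℝ, ENNReal.ofReal (Real.exp
      (2 * (star (Complex.measurableEquivRealProd.symm p) * b).re -
        l * ‖Complex.measurableEquivRealProd.symm p‖ ^ 2)) =
      ENNReal.ofReal (Real.exp (2 * b.re * p.1 - l * p.1 ^ 2)) *
        ENNReal.ofReal (Real.exp (2 * b.im * p.2 - l * p.2 ^ 2)) := by
    intro p
    rw [← ENNReal.ofReal_mul (Real.exp_nonneg _), ← Real.exp_add,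
      measurableEquivRealProd_symm_apply', ← Complex.normSq_eq_norm_sq, Complex.normSq_apply]
    congr 2
    simp
    ring
  simp_rw [key]
  rw [lintegral_prod_mul
    (f := fun x : ℝ => ENNReal.ofReal (Real.exp (2 * b.re * x - l * x ^ 2)))
    (g := fun x : ℝ => ENNReal.ofReal (Real.exp (2 * b.im * x - l * x ^ 2)))
    (by fun_prop) (by fun_prop), lintegral_exp_quadratic_gaussianReal,
    lintegral_exp_quadratic_gaussianReal]
  split_ifs with h
  · rw [← ENNReal.ofReal_mul (by positivity)]
    congr 1
    rw [← Complex.normSq_eq_norm_sq, Complex.normSq_apply, div_mul_div_comm, ← Real.exp_add,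
      Real.mul_self_sqrt h.le]
    congr 2
    ring
  · simp

lemma exists_unitary_diagonalization {n : ℕ} {G : Matrix (Fin n) (Fin n) ℂ} (hG : G.IsHermitian) :
    ∃ (V : Matrix (Fin n) (Fin n) ℂ) (l : Fin n → ℝ), V * Vᴴ = 1 ∧ Vᴴ * V = 1 ∧
      G = V * Matrix.diagonal (fun i => (l i : ℂ)) * Vᴴ := by
  refine ⟨hG.eigenvectorUnitary, hG.eigenvalues, ?_, ?_, ?_⟩
  · exact Unitary.coe_mul_star_self hG.eigenvectorUnitary
  · exact Unitary.coe_star_mul_self hG.eigenvectorUnitary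
  · have := hG.spectral_theorem
    rw [Unitary.conjStarAlgAut_apply] at this
    exact this

-- In an eigenbasis of `G` the integral is a product of scalar ones. Finiteness is decided by the
-- eigenvalues of `1 + G` alone, independently of `b`.
open Classical in
lemma lintegral_exp_quadratic_complexGaussianVec {n : ℕ} {G : Matrix (Fin n) (Fin n) ℂ}
    (hG : G.IsHermitian) (b : Fin n → ℂ) :
    ∫⁻ x, ENNReal.ofReal (Real.exp (2 * (star x ⬝ᵥ b).re - (star x ⬝ᵥ (G *ᵥ x)).re))
        ∂complexGaussianVec n 1 =
      if (1 + G).PosDef then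
        ENNReal.ofReal (Real.exp (star b ⬝ᵥ ((1 + G)⁻¹ *ᵥ b)).re / (1 + G).det.re) else ⊤ := by
  obtain ⟨V, l, hV, hV', hGV⟩ := exists_unitary_diagonalization hG
  have hM : 1 + G = V * Matrix.diagonal (fun i => ((1 + l i : ℝ) : ℂ)) * Vᴴ := by
    have : (Matrix.diagonal (fun i => ((1 + l i : ℝ) : ℂ))) =
        1 + Matrix.diagonal (fun i => (l i : ℂ)) := by
      rw [← Matrix.diagonal_one, Matrix.diagonal_add]; simp
    rw [this, hGV, mul_add, add_mul, mul_one, hV]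
  have hVu : IsUnit V := ⟨⟨V, Vᴴ, hV, hV'⟩, rfl⟩
  have hpd : (1 + G).PosDef ↔ ∀ i, 0 < 1 + l i := by
    have h2 := Matrix.IsUnit.posDef_star_right_conjugate_iff
      (x := Matrix.diagonal (fun i => ((1 + l i : ℝ) : ℂ))) hVu
    rw [hM]
    refine h2.trans ?_
    rw [Matrix.posDef_diagonal_iff]
    simp only [Complex.zero_lt_real]
  conv_lhs => rw [← map_mulVec_complexGaussianVec n 1 V hV]
  have hcont : Continuous fun x : Fin n → ℂ => V *ᵥ x :=
    Continuous.matrix_mulVec continuous_const continuous_id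
  have hF : Measurable fun x : Fin n → ℂ => ENNReal.ofReal
      (Real.exp (2 * (star x ⬝ᵥ b).re - (star x ⬝ᵥ (G *ᵥ x)).re)) :=
    ENNReal.measurable_ofReal.comp (Continuous.measurable (by fun_prop))
  rw [lintegral_map hF hcont.measurable]
  have hfac : ∀ x : Fin n → ℂ, ENNReal.ofReal (Real.exp (2 * (star (V *ᵥ x) ⬝ᵥ b).re -
      (star (V *ᵥ x) ⬝ᵥ (G *ᵥ (V *ᵥ x))).re)) =
      ∏ i, ENNReal.ofReal (Real.exp (2 * (star (x i) * (Vᴴ *ᵥ b) i).re - l i * ‖x i‖ ^ 2)) := by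
    intro x
    rw [← ENNReal.ofReal_prod_of_nonneg (fun i _ => Real.exp_nonneg _), ← Real.exp_sum,
      dotProduct_star_conjTranspose_mulVec, dotProduct_star_conjTranspose_mulVec,
      Matrix.mulVec_mulVec, Matrix.mulVec_mulVec]
    have : Vᴴ * G * V = Matrix.diagonal (fun i => (l i : ℂ)) := by
      rw [hGV, ← mul_assoc, ← mul_assoc, hV', one_mul, mul_assoc, hV', mul_one]
    rw [this, Finset.sum_sub_distrib, ← Finset.mul_sum]
    congr 3
    · simp [dotProduct]
    · simp only [dotProduct, Matrix.mulVec_diagonal, Complex.re_sum]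
      refine Finset.sum_congr rfl fun i _ => ?_
      rw [← Complex.normSq_eq_norm_sq, Complex.normSq_apply]
      simp
      ring
  simp_rw [hfac]
  have hprod := lintegral_prod_eq_prod_lintegral_of_indepFun (μ := complexGaussianVec n 1)
    Finset.univ
    (fun i (x : Fin n → ℂ) => ENNReal.ofReal
      (Real.exp (2 * (star (x i) * (Vᴴ *ᵥ b) i).re - l i * ‖x i‖ ^ 2)))
    (iIndepFun_pi (μ := fun _ => complexGaussian 1) (X := fun i z => ENNReal.ofReal
      (Real.exp (2 * (star z * (Vᴴ *ᵥ b) i).re - l i * ‖z‖ ^ 2))) (fun i => by fun_prop))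
    (fun i => by fun_prop)
  rw [hprod]
  have hone : ∀ i, ∫⁻ x : Fin n → ℂ, ENNReal.ofReal
      (Real.exp (2 * (star (x i) * (Vᴴ *ᵥ b) i).re - l i * ‖x i‖ ^ 2)) ∂complexGaussianVec n 1 =
      if 0 < 1 + l i then
        ENNReal.ofReal (Real.exp (‖(Vᴴ *ᵥ b) i‖ ^ 2 / (1 + l i)) / (1 + l i)) else ⊤ := by
    intro i
    rw [← lintegral_exp_quadratic_complexGaussian]
    exact (measurePreserving_eval (fun _ : Fin n => complexGaussian 1) i).lintegral_comp
      (f := fun z => ENNReal.ofReal (Real.exp (2 * (star z * (Vᴴ *ᵥ b) i).re - l i * ‖z‖ ^ 2)))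
      (by fun_prop)
  simp_rw [hone]
  by_cases hall : ∀ i, 0 < 1 + l i
  · rw [if_pos (hpd.2 hall)]
    simp_rw [if_pos (hall _)]
    rw [← ENNReal.ofReal_prod_of_nonneg (fun i _ => div_nonneg (Real.exp_nonneg _) (hall i).le)]
    congr 1
    rw [Finset.prod_div_distrib, ← Real.exp_sum]
    have hinv : (1 + G)⁻¹ = V * Matrix.diagonal (fun i => (((1 + l i)⁻¹ : ℝ) : ℂ)) * Vᴴ := by
      apply Matrix.inv_eq_right_inv
      rw [hM]
      calc V * Matrix.diagonal (fun i => ((1 + l i : ℝ) : ℂ)) * Vᴴ *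
            (V * Matrix.diagonal (fun i => (((1 + l i)⁻¹ : ℝ) : ℂ)) * Vᴴ)
          = V * (Matrix.diagonal (fun i => ((1 + l i : ℝ) : ℂ)) * (Vᴴ * V) *
            Matrix.diagonal (fun i => (((1 + l i)⁻¹ : ℝ) : ℂ))) * Vᴴ := by
            simp only [Matrix.mul_assoc]
        _ = 1 := by
            rw [hV', mul_one, Matrix.diagonal_mul_diagonal]
            have : (fun i => ((1 + l i : ℝ) : ℂ) * (((1 + l i)⁻¹ : ℝ) : ℂ)) = fun _ => 1 := by
              ext i
              rw [← Complex.ofReal_mul, mul_inv_cancel₀ (hall i).ne', Complex.ofReal_one]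
            rw [this, Matrix.diagonal_one, mul_one, hV]
    congr 2
    · rw [hinv, ← Matrix.mulVec_mulVec, ← Matrix.mulVec_mulVec]
      have := dotProduct_star_conjTranspose_mulVec Vᴴ b
        (Matrix.diagonal (fun i => (((1 + l i)⁻¹ : ℝ) : ℂ)) *ᵥ (Vᴴ *ᵥ b))
      rw [Matrix.conjTranspose_conjTranspose] at this
      rw [← this]
      simp only [dotProduct, Matrix.mulVec_diagonal, Complex.re_sum]
      refine Finset.sum_congr rfl fun i _ => ?_
      rw [← Complex.normSq_eq_norm_sq, Complex.normSq_apply, div_eq_mul_inv]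
      simp [-Complex.ofReal_inv, -Complex.ofReal_add]
      ring
    · rw [hM, Matrix.det_mul, Matrix.det_mul, Matrix.det_diagonal, mul_right_comm,
        ← Matrix.det_mul, hV, Matrix.det_one, one_mul, ← Complex.ofReal_prod, Complex.ofReal_re]
  · rw [if_neg (fun h => hall (hpd.1 h))]
    push Not at hall
    obtain ⟨i, hi⟩ := hall
    -- One infinite factor makes the product infinite only because no other factor is zero.
    have hne : ∀ j, (if 0 < 1 + l j then
        ENNReal.ofReal (Real.exp (‖(Vᴴ *ᵥ b) j‖ ^ 2 / (1 + l j)) / (1 + l j)) else ⊤) ≠ 0 := by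
      intro j
      split_ifs with h
      · simp only [ne_eq, ENNReal.ofReal_eq_zero, not_le]; positivity
      · simp
    rw [← Finset.mul_prod_erase _ _ (Finset.mem_univ i), if_neg hi.not_gt]
    exact ENNReal.top_mul (Finset.prod_ne_zero_iff.2 fun j _ => hne j)

/-! ### The output metric in closed form -/

namespace Receiver

variable {nT nR K : ℕ} (r : Receiver nT nR K)

lemma metric_nonneg (y : Fin nR → ℂ) (x : Fin nT → ℂ) : 0 ≤ r.metric y x := Real.exp_nonneg _

open Classical in
lemma lintegral_metric (y : Fin nR → ℂ) :
    ∫⁻ x, ENNReal.ofReal (r.metric y x) ∂complexGaussianVec nT 1 =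
      if (1 + r.Gr).PosDef then
        ENNReal.ofReal (Real.exp (star (r.Hr *ᵥ y) ⬝ᵥ ((1 + r.Gr)⁻¹ *ᵥ (r.Hr *ᵥ y))).re /
          (1 + r.Gr).det.re) else ⊤ :=
  lintegral_exp_quadratic_complexGaussianVec r.isHermitian (r.Hr *ᵥ y)

lemma continuous_metric (y : Fin nR → ℂ) : Continuous (r.metric y) := by
  unfold metric; fun_prop

lemma integrable_metric_iff (y : Fin nR → ℂ) :
    Integrable (r.metric y) (complexGaussianVec nT 1) ↔ (1 + r.Gr).PosDef := by
  have hm : AEStronglyMeasurable (r.metric y) (complexGaussianVec nT 1) :=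
    (r.continuous_metric y).aestronglyMeasurable
  rw [Integrable, and_iff_right hm,
    hasFiniteIntegral_iff_ofReal (ae_of_all _ (r.metric_nonneg y)), r.lintegral_metric]
  split_ifs with h <;> simp [h]

lemma log_outputMetric (h : (1 + r.Gr).PosDef) (y : Fin nR → ℂ) :
    Real.log (r.outputMetric y) =
      (star (r.Hr *ᵥ y) ⬝ᵥ ((1 + r.Gr)⁻¹ *ᵥ (r.Hr *ᵥ y))).re - Real.log (1 + r.Gr).det.re := by
  have hdet : 0 < (1 + r.Gr).det.re := (Complex.lt_def.1 h.det_pos).1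
  rw [outputMetric, integral_eq_lintegral_of_nonneg_ae (ae_of_all _ (r.metric_nonneg y))
    (r.continuous_metric y).aestronglyMeasurable, r.lintegral_metric, if_pos h,
    ENNReal.toReal_ofReal (by positivity), Real.log_div (Real.exp_ne_zero _) hdet.ne',
    Real.log_exp]

end Receiver

/-! ### Second moments and expected quadratic forms -/

lemma integrable_sq_gaussianReal (v : ℝ≥0) : Integrable (fun x : ℝ => x ^ 2) (gaussianReal 0 v) :=
  (memLp_id_gaussianReal 2).integrable_sq

lemma integral_sq_gaussianReal (v : ℝ≥0) : ∫ x, x ^ 2 ∂gaussianReal 0 v = v := by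
  have := variance_fun_id_gaussianReal (μ := 0) (v := v)
  rw [variance_eq_integral measurable_id'.aemeasurable] at this
  simpa using this

lemma norm_sq_measurableEquivRealProd_symm (p : ℝ × ℝ) :
    ‖Complex.measurableEquivRealProd.symm p‖ ^ 2 = p.1 ^ 2 + p.2 ^ 2 := by
  rw [measurableEquivRealProd_symm_apply', ← Complex.normSq_eq_norm_sq, Complex.normSq_apply]
  ring

lemma integrable_norm_sq_complexGaussian (v : ℝ≥0) :
    Integrable (fun z : ℂ => ‖z‖ ^ 2) (complexGaussian v) := by
  rw [complexGaussian, integrable_map_equiv]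
  simp_rw [Function.comp_def, norm_sq_measurableEquivRealProd_symm]
  exact ((integrable_sq_gaussianReal _).comp_fst _).add ((integrable_sq_gaussianReal _).comp_snd _)

lemma integral_norm_sq_complexGaussian (v : ℝ≥0) :
    ∫ z, ‖z‖ ^ 2 ∂complexGaussian v = v := by
  rw [complexGaussian, integral_map_equiv]
  simp_rw [norm_sq_measurableEquivRealProd_symm]
  rw [integral_add ((integrable_sq_gaussianReal _).comp_fst _)
    ((integrable_sq_gaussianReal _).comp_snd _),
    integral_fun_fst (fun x : ℝ => x ^ 2), integral_fun_snd (fun x : ℝ => x ^ 2),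
    integral_sq_gaussianReal]
  simp

lemma memLp_id_complexGaussian (v : ℝ≥0) : MemLp (fun z : ℂ => z) 2 (complexGaussian v) :=
  (memLp_two_iff_integrable_sq_norm (by fun_prop)).2 (integrable_norm_sq_complexGaussian v)

lemma integral_id_complexGaussian (v : ℝ≥0) : ∫ z, z ∂complexGaussian v = 0 := by
  have hint : Integrable (fun z : ℂ => z) (complexGaussian v) :=
    (memLp_id_complexGaussian v).integrable (by norm_num)
  apply Complex.ext
  · have h : (∫ z, z ∂complexGaussian v).re = ∫ z, z.re ∂complexGaussian v :=
      (Complex.reCLM.integral_comp_comm hint).symm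
    rw [h, complexGaussian, integral_map_equiv]
    simp_rw [measurableEquivRealProd_symm_apply']
    rw [integral_fun_fst (fun x : ℝ => x)]
    simp
  · have h : (∫ z, z ∂complexGaussian v).im = ∫ z, z.im ∂complexGaussian v :=
      (Complex.imCLM.integral_comp_comm hint).symm
    rw [h, complexGaussian, integral_map_equiv]
    simp_rw [measurableEquivRealProd_symm_apply']
    rw [integral_fun_snd (fun x : ℝ => x)]
    simp

lemma memLp_eval_complexGaussianVec {n : ℕ} (v : ℝ≥0) (i : Fin n) :
    MemLp (fun x : Fin n → ℂ => x i) 2 (complexGaussianVec n v) :=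
  (memLp_id_complexGaussian v).comp_measurePreserving
    (measurePreserving_eval (fun _ : Fin n => complexGaussian v) i)

lemma integral_eval_complexGaussianVec {n : ℕ} (v : ℝ≥0) (i : Fin n) :
    ∫ x : Fin n → ℂ, x i ∂complexGaussianVec n v = 0 := by
  rw [complexGaussianVec, integral_comp_eval (μ := fun _ : Fin n => complexGaussian v)
    (f := fun z : ℂ => z) (by fun_prop), integral_id_complexGaussian]

lemma memLp_star {α : Type*} [MeasurableSpace α] {μ : Measure α} {f : α → ℂ} (hf : MemLp f 2 μ) :
    MemLp (fun x => star (f x)) 2 μ := hf.star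

lemma integral_star_mul_eval_complexGaussianVec {n : ℕ} (v : ℝ≥0) (i j : Fin n) :
    ∫ x : Fin n → ℂ, star (x i) * x j ∂complexGaussianVec n v = if i = j then (v : ℂ) else 0 := by
  split_ifs with h
  · subst h
    have : ∀ z : ℂ, star z * z = ((‖z‖ ^ 2 : ℝ) : ℂ) := fun z => by
      rw [← Complex.normSq_eq_norm_sq, Complex.normSq_eq_conj_mul_self]; rfl
    simp_rw [this]
    rw [integral_complex_ofReal, complexGaussianVec,
      integral_comp_eval (μ := fun _ : Fin n => complexGaussian v)
      (f := fun z : ℂ => ‖z‖ ^ 2) (by fun_prop), integral_norm_sq_complexGaussian]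
  · have hind : iIndepFun (fun (i : Fin n) (x : Fin n → ℂ) => x i) (complexGaussianVec n v) :=
      iIndepFun_pi (μ := fun _ : Fin n => complexGaussian v) (X := fun _ z => z)
        (fun i => by fun_prop)
    have h2 : IndepFun (fun x : Fin n → ℂ => star (x i)) (fun x => x j) (complexGaussianVec n v) :=
      (hind.indepFun h).comp (φ := star) (ψ := id) (by fun_prop) measurable_id
    rw [h2.integral_fun_mul_eq_mul_integral
      (memLp_star (memLp_eval_complexGaussianVec v i)).aestronglyMeasurable
      (memLp_eval_complexGaussianVec v j).aestronglyMeasurable,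
      integral_eval_complexGaussianVec, mul_zero]

lemma quadratic_eq_sum {m n : Type*} [Fintype m] [Fintype n] (R : Matrix m n ℂ) (x : m → ℂ)
    (y : n → ℂ) : star x ⬝ᵥ (R *ᵥ y) = ∑ i, ∑ j, R i j * (star (x i) * y j) := by
  simp only [dotProduct, Matrix.mulVec, Pi.star_apply, Finset.mul_sum]
  exact Finset.sum_congr rfl fun i _ => Finset.sum_congr rfl fun j _ => by ring

lemma integrable_quadratic_of_memLp {Ω : Type*} [MeasurableSpace Ω] {μ : Measure Ω}
    {m n : Type*} [Fintype m] [Fintype n] (R : Matrix m n ℂ) {X : Ω → m → ℂ} {Y : Ω → n → ℂ}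
    (hX : ∀ i, MemLp (fun ω => X ω i) 2 μ) (hY : ∀ i, MemLp (fun ω => Y ω i) 2 μ) :
    Integrable (fun ω => star (X ω) ⬝ᵥ (R *ᵥ Y ω)) μ := by
  simp_rw [quadratic_eq_sum]
  refine integrable_finsetSum _ fun i _ => integrable_finsetSum _ fun j _ => ?_
  exact ((memLp_star (hX i)).integrable_mul (hY j)).const_mul _

lemma integral_quadratic_of_memLp {Ω : Type*} [MeasurableSpace Ω] {μ : Measure Ω}
    {m n : Type*} [Fintype m] [Fintype n] (R : Matrix m n ℂ) {X : Ω → m → ℂ} {Y : Ω → n → ℂ}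
    (hX : ∀ i, MemLp (fun ω => X ω i) 2 μ) (hY : ∀ i, MemLp (fun ω => Y ω i) 2 μ) :
    ∫ ω, star (X ω) ⬝ᵥ (R *ᵥ Y ω) ∂μ = ∑ i, ∑ j, R i j * ∫ ω, star (X ω i) * Y ω j ∂μ := by
  simp_rw [quadratic_eq_sum]
  rw [integral_finsetSum]
  · refine Finset.sum_congr rfl fun i _ => ?_
    rw [integral_finsetSum]
    · exact Finset.sum_congr rfl fun j _ => integral_const_mul _ _
    · exact fun j _ => ((memLp_star (hX i)).integrable_mul (hY j)).const_mul _
  · exact fun i _ => integrable_finsetSum _ fun j _ =>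
      ((memLp_star (hX i)).integrable_mul (hY j)).const_mul _

section Joint

variable {nT nR : ℕ} (N₀ : ℝ≥0)

/-- The joint law of input and noise. -/
noncomputable def inputNoiseLaw (nT nR : ℕ) (N₀ : ℝ≥0) :
    Measure ((Fin nT → ℂ) × (Fin nR → ℂ)) :=
  (complexGaussianVec nT 1).prod (complexGaussianVec nR N₀)

instance isProbabilityMeasure_inputNoiseLaw : IsProbabilityMeasure (inputNoiseLaw nT nR N₀) := by
  unfold inputNoiseLaw; infer_instance

lemma memLp_input (i : Fin nT) :
    MemLp (fun p : (Fin nT → ℂ) × (Fin nR → ℂ) => p.1 i) 2 (inputNoiseLaw nT nR N₀) :=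
  (memLp_eval_complexGaussianVec 1 i).comp_measurePreserving measurePreserving_fst

lemma memLp_noise (i : Fin nR) :
    MemLp (fun p : (Fin nT → ℂ) × (Fin nR → ℂ) => p.2 i) 2 (inputNoiseLaw nT nR N₀) :=
  (memLp_eval_complexGaussianVec N₀ i).comp_measurePreserving measurePreserving_snd

lemma sum_sum_mul_ite {n : ℕ} (R : Matrix (Fin n) (Fin n) ℂ) (c : ℂ) :
    ∑ i, ∑ j, R i j * (if i = j then c else 0) = c * R.trace := by
  simp [Matrix.trace, Finset.mul_sum, mul_comm]

lemma integral_input_input (R : Matrix (Fin nT) (Fin nT) ℂ) :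
    ∫ p, star p.1 ⬝ᵥ (R *ᵥ p.1) ∂inputNoiseLaw nT nR N₀ = R.trace := by
  rw [integral_quadratic_of_memLp R (memLp_input N₀) (memLp_input N₀)]
  have : ∀ i j, ∫ p : (Fin nT → ℂ) × (Fin nR → ℂ), star (p.1 i) * p.1 j ∂inputNoiseLaw nT nR N₀ =
      if i = j then ((1 : ℝ≥0) : ℂ) else 0 := by
    intro i j
    rw [inputNoiseLaw, integral_fun_fst (fun x : Fin nT → ℂ => star (x i) * x j),
      integral_star_mul_eval_complexGaussianVec]
    simp
  simp_rw [this]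
  rw [sum_sum_mul_ite]
  simp

lemma integral_noise_noise (R : Matrix (Fin nR) (Fin nR) ℂ) :
    ∫ p, star p.2 ⬝ᵥ (R *ᵥ p.2) ∂inputNoiseLaw nT nR N₀ = N₀ * R.trace := by
  rw [integral_quadratic_of_memLp R (memLp_noise N₀) (memLp_noise N₀)]
  have : ∀ i j, ∫ p : (Fin nT → ℂ) × (Fin nR → ℂ), star (p.2 i) * p.2 j ∂inputNoiseLaw nT nR N₀ =
      if i = j then (N₀ : ℂ) else 0 := by
    intro i j
    rw [inputNoiseLaw, integral_fun_snd (fun x : Fin nR → ℂ => star (x i) * x j),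
      integral_star_mul_eval_complexGaussianVec]
    simp
  simp_rw [this]
  rw [sum_sum_mul_ite]

lemma integral_input_noise (R : Matrix (Fin nT) (Fin nR) ℂ) :
    ∫ p, star p.1 ⬝ᵥ (R *ᵥ p.2) ∂inputNoiseLaw nT nR N₀ = 0 := by
  rw [integral_quadratic_of_memLp R (memLp_input N₀) (memLp_noise N₀)]
  refine Finset.sum_eq_zero fun i _ => Finset.sum_eq_zero fun j _ => ?_
  rw [inputNoiseLaw, integral_prod_mul (fun x : Fin nT → ℂ => star (x i)) (fun x : Fin nR → ℂ => x j),
    integral_eval_complexGaussianVec, mul_zero, mul_zero]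

lemma integral_noise_input (R : Matrix (Fin nR) (Fin nT) ℂ) :
    ∫ p, star p.2 ⬝ᵥ (R *ᵥ p.1) ∂inputNoiseLaw nT nR N₀ = 0 := by
  rw [integral_quadratic_of_memLp R (memLp_noise N₀) (memLp_input N₀)]
  refine Finset.sum_eq_zero fun i _ => Finset.sum_eq_zero fun j _ => ?_
  simp_rw [mul_comm (star _)]
  rw [inputNoiseLaw, integral_prod_mul (fun x : Fin nT → ℂ => x j) (fun x : Fin nR → ℂ => star (x i)),
    integral_eval_complexGaussianVec, zero_mul, mul_zero]

variable (H : Matrix (Fin nR) (Fin nT) ℂ)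

lemma memLp_output (i : Fin nR) :
    MemLp (fun p : (Fin nT → ℂ) × (Fin nR → ℂ) => (H *ᵥ p.1 + p.2) i) 2
      (inputNoiseLaw nT nR N₀) := by
  simp only [Pi.add_apply, Matrix.mulVec, dotProduct]
  exact (memLp_finsetSum _ fun j _ => (memLp_input N₀ j).const_mul _).add (memLp_noise N₀ i)

lemma integral_output_output (Q : Matrix (Fin nR) (Fin nR) ℂ) :
    ∫ p, star (H *ᵥ p.1 + p.2) ⬝ᵥ (Q *ᵥ (H *ᵥ p.1 + p.2)) ∂inputNoiseLaw nT nR N₀ =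
      (Hᴴ * Q * H).trace + N₀ * Q.trace := by
  have hexp : ∀ p : (Fin nT → ℂ) × (Fin nR → ℂ),
      star (H *ᵥ p.1 + p.2) ⬝ᵥ (Q *ᵥ (H *ᵥ p.1 + p.2)) =
      (star p.1 ⬝ᵥ ((Hᴴ * Q * H) *ᵥ p.1) + star p.1 ⬝ᵥ ((Hᴴ * Q) *ᵥ p.2)) +
      (star p.2 ⬝ᵥ ((Q * H) *ᵥ p.1) + star p.2 ⬝ᵥ (Q *ᵥ p.2)) := by
    intro p
    rw [star_add, add_dotProduct, dotProduct_star_conjTranspose_mulVec, Matrix.mulVec_add,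
      Matrix.mulVec_add, dotProduct_add, dotProduct_add]
    simp only [Matrix.mulVec_mulVec, Matrix.mul_assoc]
  simp_rw [hexp]
  have h1 := integrable_quadratic_of_memLp (Hᴴ * Q * H) (memLp_input (nR := nR) N₀) (memLp_input N₀)
  have h2 := integrable_quadratic_of_memLp (Hᴴ * Q) (memLp_input N₀) (memLp_noise N₀)
  have h3 := integrable_quadratic_of_memLp (Q * H) (memLp_noise N₀) (memLp_input N₀)
  have h4 := integrable_quadratic_of_memLp Q (memLp_noise (nT := nT) N₀) (memLp_noise N₀)
  rw [integral_add (Integrable.fun_add h1 h2) (Integrable.fun_add h3 h4), integral_add h1 h2, integral_add h3 h4,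
    integral_input_input, integral_input_noise, integral_noise_input, integral_noise_noise]
  ring

lemma integral_input_output (R : Matrix (Fin nT) (Fin nR) ℂ) :
    ∫ p, star p.1 ⬝ᵥ (R *ᵥ (H *ᵥ p.1 + p.2)) ∂inputNoiseLaw nT nR N₀ = (R * H).trace := by
  simp_rw [Matrix.mulVec_add, dotProduct_add, Matrix.mulVec_mulVec]
  rw [integral_add (integrable_quadratic_of_memLp (R * H) (memLp_input N₀) (memLp_input N₀))
    (integrable_quadratic_of_memLp R (memLp_input N₀) (memLp_noise N₀)),
    integral_input_input, integral_input_noise, add_zero]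

lemma integral_re_complex {Ω : Type*} [MeasurableSpace Ω] {μ : Measure Ω} {f : Ω → ℂ}
    (hf : Integrable f μ) : ∫ ω, (f ω).re ∂μ = (∫ ω, f ω ∂μ).re :=
  Complex.reCLM.integral_comp_comm hf

end Joint

/-! ### The generalized mutual information in closed form -/

namespace Receiver

variable {nT nR K : ℕ} (r : Receiver nT nR K)

/-- The matrix of the quadratic form in the output that is the logarithm of the output metric. -/
noncomputable def outputForm : Matrix (Fin nR) (Fin nR) ℂ := r.Hrᴴ * (1 + r.Gr)⁻¹ * r.Hr

/-- The generalized mutual information of a receiver with `1 + Gr` positive definite. -/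
noncomputable def gmiReal (H : Matrix (Fin nR) (Fin nT) ℂ) (N₀ : ℝ≥0) : ℝ :=
  Real.log (1 + r.Gr).det.re - ((Hᴴ * r.outputForm * H).trace + N₀ * r.outputForm.trace).re +
    (2 * (r.Hr * H).trace.re - r.Gr.trace.re)

lemma gmi_eq_of_posDef (h : (1 + r.Gr).PosDef) (H : Matrix (Fin nR) (Fin nT) ℂ) (N₀ : ℝ≥0) :
    r.gmi H N₀ = (r.gmiReal H N₀ : EReal) := by
  have hmap : Measurable fun p : (Fin nT → ℂ) × (Fin nR → ℂ) => (p.1, H *ᵥ p.1 + p.2) :=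
    Continuous.measurable (by fun_prop)
  rw [gmi, if_pos fun y => (r.integrable_metric_iff y).2 h, EReal.coe_eq_coe_iff]
  have hform : ∀ y : Fin nR → ℂ, star (r.Hr *ᵥ y) ⬝ᵥ ((1 + r.Gr)⁻¹ *ᵥ (r.Hr *ᵥ y)) =
      star y ⬝ᵥ (r.outputForm *ᵥ y) := by
    intro y
    rw [dotProduct_star_conjTranspose_mulVec, Matrix.mulVec_mulVec, Matrix.mulVec_mulVec,
      outputForm]
  have h1 : ∫ p, Real.log (r.outputMetric p.2) ∂inputOutputLaw H N₀ =
      ((Hᴴ * r.outputForm * H).trace + N₀ * r.outputForm.trace).re -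
        Real.log (1 + r.Gr).det.re := by
    simp_rw [r.log_outputMetric h, hform]
    rw [inputOutputLaw, integral_map hmap.aemeasurable
      (Continuous.aestronglyMeasurable (by fun_prop))]
    have hint := integrable_quadratic_of_memLp r.outputForm (memLp_output N₀ H) (memLp_output N₀ H)
    rw [← integral_output_output, ← integral_re_complex hint]
    change ∫ p, _ ∂inputNoiseLaw nT nR N₀ = _
    have hre : Integrable (fun p : (Fin nT → ℂ) × (Fin nR → ℂ) => (star (H *ᵥ p.1 + p.2) ⬝ᵥ
        (r.outputForm *ᵥ (H *ᵥ p.1 + p.2))).re) (inputNoiseLaw nT nR N₀) := hint.re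
    rw [integral_sub hre (integrable_const _)]
    simp
  have h2 : ∫ p, Real.log (r.metric p.2 p.1) ∂inputOutputLaw H N₀ =
      2 * (r.Hr * H).trace.re - r.Gr.trace.re := by
    simp_rw [metric, Real.log_exp]
    rw [inputOutputLaw, integral_map hmap.aemeasurable
      (Continuous.aestronglyMeasurable (by fun_prop))]
    change ∫ p, _ ∂inputNoiseLaw nT nR N₀ = _
    have hint1 := integrable_quadratic_of_memLp r.Hr (memLp_input N₀) (memLp_output N₀ H)
    have hint2 := integrable_quadratic_of_memLp r.Gr (memLp_input (nR := nR) N₀) (memLp_input N₀)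
    have hre1 : Integrable (fun p : (Fin nT → ℂ) × (Fin nR → ℂ) => (star p.1 ⬝ᵥ
        (r.Hr *ᵥ (H *ᵥ p.1 + p.2))).re) (inputNoiseLaw nT nR N₀) := hint1.re
    have hre2 : Integrable (fun p : (Fin nT → ℂ) × (Fin nR → ℂ) => (star p.1 ⬝ᵥ
        (r.Gr *ᵥ p.1)).re) (inputNoiseLaw nT nR N₀) := hint2.re
    rw [integral_sub (hre1.const_mul 2) hre2, integral_const_mul]
    rw [← integral_input_output N₀ H r.Hr, ← integral_input_input (nR := nR) N₀ r.Gr,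
      ← integral_re_complex hint1, ← integral_re_complex hint2]
  rw [h1, h2, gmiReal]
  ring

lemma gmi_eq_bot (h : ¬ (1 + r.Gr).PosDef) (H : Matrix (Fin nR) (Fin nT) ℂ) (N₀ : ℝ≥0) :
    r.gmi H N₀ = ⊥ := by
  rw [gmi, if_neg]
  exact fun hy => h ((r.integrable_metric_iff 0).1 (hy 0))

end Receiver

/-! ### Linear estimation and the optimal front end -/

section Estimation

variable {nT nR : ℕ} (H : Matrix (Fin nR) (Fin nT) ℂ) (N₀ : ℝ≥0)

/-- The covariance matrix of the output. -/
noncomputable def outputCov : Matrix (Fin nR) (Fin nR) ℂ := H * Hᴴ + (N₀ : ℂ) • 1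

/-- The error covariance matrix of the linear minimum mean square error estimate of the input. -/
noncomputable def errorCov : Matrix (Fin nT) (Fin nT) ℂ := 1 - Hᴴ * (outputCov H N₀)⁻¹ * H

variable {N₀}

lemma posDef_outputCov (hN : 0 < N₀) : (outputCov H N₀).PosDef := by
  refine Matrix.PosDef.posSemidef_add (Matrix.posSemidef_self_mul_conjTranspose H)
    (Matrix.PosDef.one.smul ?_)
  exact_mod_cast hN

lemma conjTranspose_inv_outputCov (hN : 0 < N₀) :
    ((outputCov H N₀)⁻¹)ᴴ = (outputCov H N₀)⁻¹ :=
  (posDef_outputCov H hN).inv.isHermitian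

lemma outputCov_mul_inv (hN : 0 < N₀) : outputCov H N₀ * (outputCov H N₀)⁻¹ = 1 :=
  Matrix.mul_nonsing_inv _ ((Matrix.isUnit_iff_isUnit_det _).1 (posDef_outputCov H hN).isUnit)

lemma inv_mul_outputCov (hN : 0 < N₀) : (outputCov H N₀)⁻¹ * outputCov H N₀ = 1 :=
  Matrix.nonsing_inv_mul _ ((Matrix.isUnit_iff_isUnit_det _).1 (posDef_outputCov H hN).isUnit)

/-- Applied with `P = (1 + Gr)⁻¹` and `D` the deviation of `Hr` from its optimum, this is the rate
lost by a suboptimal front end. Splitting the covariance leaves traces of two positive semidefinite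
matrices. -/
lemma re_trace_conjTranspose_mul_mul_outputCov_nonneg {P : Matrix (Fin nT) (Fin nT) ℂ}
    (hP : P.PosSemidef) (D : Matrix (Fin nT) (Fin nR) ℂ) :
    0 ≤ (Dᴴ * P * D * outputCov H N₀).trace.re := by
  have h : (Dᴴ * P * D * outputCov H N₀).trace =
      ((D * H)ᴴ * P * (D * H)).trace + N₀ * (Dᴴ * P * D).trace := by
    rw [outputCov, mul_add, Matrix.trace_add, mul_smul_comm, mul_one, Matrix.trace_smul,
      smul_eq_mul, ← Matrix.mul_assoc, Matrix.trace_mul_comm, Matrix.conjTranspose_mul]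
    simp only [Matrix.mul_assoc]
  rw [h]
  have h1 := (hP.conjTranspose_mul_mul_same (D * H)).trace_nonneg
  have h2 := (hP.conjTranspose_mul_mul_same D).trace_nonneg
  have h3 : (0 : ℂ) ≤ (N₀ : ℂ) * (Dᴴ * P * D).trace := mul_nonneg (by simp) h2
  exact (Complex.le_def.1 (add_nonneg h1 h3)).1

end Estimation

namespace Receiver

variable {nT nR K : ℕ} (r : Receiver nT nR K)

/-- Completing the square in `Hr`: the final trace is the only term that still contains `Hr`. -/
lemma gmiReal_eq (h : (1 + r.Gr).PosDef) (H : Matrix (Fin nR) (Fin nT) ℂ) {N₀ : ℝ≥0}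
    (hN : 0 < N₀) :
    r.gmiReal H N₀ =
      Real.log (1 + r.Gr).det.re - ((1 + r.Gr) * errorCov H N₀).trace.re + nT -
      ((r.Hr - (1 + r.Gr) * Hᴴ * (outputCov H N₀)⁻¹)ᴴ * (1 + r.Gr)⁻¹ *
        (r.Hr - (1 + r.Gr) * Hᴴ * (outputCov H N₀)⁻¹) * outputCov H N₀).trace.re := by
  rw [gmiReal, outputForm]
  have htrG : r.Gr.trace = (1 + r.Gr).trace - nT := by
    simp [Matrix.trace_add, Matrix.trace_one]
  rw [htrG]
  set M := 1 + r.Gr with hM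
  set Y := outputCov H N₀ with hY
  have hMM : M⁻¹ * M = 1 :=
    Matrix.nonsing_inv_mul _ ((Matrix.isUnit_iff_isUnit_det _).1 h.isUnit)
  have hMM' : M * M⁻¹ = 1 :=
    Matrix.mul_nonsing_inv _ ((Matrix.isUnit_iff_isUnit_det _).1 h.isUnit)
  have hYH : (Y⁻¹)ᴴ = Y⁻¹ := conjTranspose_inv_outputCov H hN
  have hYY : Y⁻¹ * Y = 1 := inv_mul_outputCov H hN
  have hYY' : Y * Y⁻¹ = 1 := outputCov_mul_inv H hN
  have hprod : (r.Hr - M * Hᴴ * Y⁻¹)ᴴ * M⁻¹ * (r.Hr - M * Hᴴ * Y⁻¹) * Y =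
      r.Hrᴴ * M⁻¹ * r.Hr * Y - r.Hrᴴ * Hᴴ - Y⁻¹ * (H * r.Hr) * Y + Y⁻¹ * (H * M * Hᴴ) := by
    have hD : (r.Hr - M * Hᴴ * Y⁻¹) * Y = r.Hr * Y - M * Hᴴ := by
      rw [Matrix.sub_mul, Matrix.mul_assoc, hYY, Matrix.mul_one]
    have hMD : M⁻¹ * (r.Hr * Y - M * Hᴴ) = M⁻¹ * (r.Hr * Y) - Hᴴ := by
      rw [Matrix.mul_sub, ← Matrix.mul_assoc M⁻¹ M, hMM, Matrix.one_mul]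
    have e : Y⁻¹ * (H * M) * (M⁻¹ * (r.Hr * Y)) = Y⁻¹ * (H * r.Hr) * Y := by
      calc Y⁻¹ * (H * M) * (M⁻¹ * (r.Hr * Y)) = Y⁻¹ * (H * (M * M⁻¹) * r.Hr) * Y := by
            simp only [Matrix.mul_assoc]
        _ = _ := by rw [hMM', Matrix.mul_one]
    rw [Matrix.mul_assoc, hD, Matrix.mul_assoc, hMD, Matrix.conjTranspose_sub,
      Matrix.conjTranspose_mul, Matrix.conjTranspose_mul, Matrix.conjTranspose_conjTranspose, hYH,
      h.isHermitian.eq, Matrix.sub_mul, Matrix.mul_sub, Matrix.mul_sub, e]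
    simp only [Matrix.mul_assoc]
    abel
  have t1 : (r.Hrᴴ * M⁻¹ * r.Hr * Y).trace =
      (Hᴴ * (r.Hrᴴ * M⁻¹ * r.Hr) * H).trace + N₀ * (r.Hrᴴ * M⁻¹ * r.Hr).trace := by
    rw [hY, outputCov, mul_add, Matrix.trace_add, mul_smul_comm, mul_one, Matrix.trace_smul,
      smul_eq_mul, ← Matrix.mul_assoc, Matrix.trace_mul_comm, ← Matrix.mul_assoc]
  have t2 : (r.Hrᴴ * Hᴴ).trace.re = (r.Hr * H).trace.re := by
    rw [← Matrix.conjTranspose_mul, Matrix.trace_conjTranspose, Matrix.trace_mul_comm]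
    simp
  have t3 : (Y⁻¹ * (H * r.Hr) * Y).trace = (r.Hr * H).trace := by
    rw [Matrix.trace_mul_comm, ← Matrix.mul_assoc, hYY', Matrix.one_mul, Matrix.trace_mul_comm]
  have t4 : (Y⁻¹ * (H * M * Hᴴ)).trace = M.trace - (M * errorCov H N₀).trace := by
    rw [errorCov, ← hY, Matrix.mul_sub, Matrix.trace_sub, Matrix.mul_one, sub_sub_cancel,
      Matrix.trace_mul_comm, Matrix.mul_assoc, Matrix.mul_assoc, Matrix.trace_mul_comm]
    simp only [Matrix.mul_assoc]
  clear_value M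
  rw [hprod, Matrix.trace_add, Matrix.trace_sub, Matrix.trace_sub, t1, t3, t4]
  simp only [Complex.add_re, Complex.sub_re, Complex.natCast_re, t2]
  ring

end Receiver

/-! ### Triangular factorization preserving the band -/

section Cholesky

/-- One step of Cholesky elimination: `w` is column `j` divided by the root of the pivot, so it
inherits the zeros of that column, and the remainder is a Schur complement. -/
lemma posSemidef_sub_pivot {n : ℕ} {R : Matrix (Fin n) (Fin n) ℂ} (hR : R.PosSemidef)
    (j : Fin n) :
    ∃ w : Fin n → ℂ, (∀ i, R i j = 0 → w i = 0) ∧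
      (R - Matrix.vecMulVec w (star w)).PosSemidef ∧
      ∀ i, (R - Matrix.vecMulVec w (star w)) j i = 0 := by
  have hherm : ∀ i k, star (R i k) = R k i := fun i k => hR.isHermitian.apply k i
  by_cases hc : R j j = 0
  -- A zero pivot forces the whole row to vanish: writing `R = Cᴴ C`, column `j` of `C` has norm
  -- zero.
  · refine ⟨0, fun _ _ => rfl, by simpa using hR, fun i => ?_⟩
    obtain ⟨C, hC⟩ : ∃ C : Matrix (Fin n) (Fin n) ℂ, R = Cᴴ * C := by
      open scoped MatrixOrder in
      exact CStarAlgebra.nonneg_iff_eq_star_mul_self.1 hR.nonneg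
    have hz : ∀ k, C k j = 0 := by
      rw [hC, Matrix.mul_apply] at hc
      have : ∑ k, ‖C k j‖ ^ 2 = 0 := by
        have h2 := congrArg Complex.re hc
        rw [Complex.re_sum] at h2
        rw [← Complex.zero_re, ← h2]
        refine Finset.sum_congr rfl fun k _ => ?_
        rw [← Complex.normSq_eq_norm_sq, Complex.normSq_apply]
        simp [Matrix.conjTranspose_apply]
      intro k
      have := (Finset.sum_eq_zero_iff_of_nonneg (fun k _ => by positivity)).1 this k
        (Finset.mem_univ k)
      simpa using this
    have : R j i = 0 := by
      rw [hC, Matrix.mul_apply]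
      exact Finset.sum_eq_zero fun k _ => by simp [Matrix.conjTranspose_apply, hz k]
    simp [this]
  · have hre : R j j = ((R j j).re : ℂ) := by
      have := hherm j j
      exact (Complex.conj_eq_iff_re.1 this).symm
    have hpos : 0 < (R j j).re := by
      have h0 : 0 ≤ (R j j).re := (Complex.le_def.1 (hR.diag_nonneg (i := j))).1
      refine lt_of_le_of_ne h0 fun h => hc ?_
      rw [hre, ← h, Complex.ofReal_zero]
    set c := (R j j).re with hcdef
    have hsq : ((√c : ℝ) : ℂ) * ((√c : ℝ) : ℂ) = (c : ℂ) := by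
      rw [← Complex.ofReal_mul, Real.mul_self_sqrt hpos.le]
    have hsc : ((√c : ℝ) : ℂ) ≠ 0 := by
      rw [Complex.ofReal_ne_zero]; positivity
    have hcc : (c : ℂ) ≠ 0 := by rw [Complex.ofReal_ne_zero]; exact hpos.ne'
    set w : Fin n → ℂ := fun i => R i j / (√c : ℝ) with hw
    have hent : ∀ i k, (R - Matrix.vecMulVec w (star w)) i k = R i k - R i j * R j k / c := by
      intro i k
      have : star (w k) = R j k / (√c : ℝ) := by
        simp only [hw, Complex.star_def, map_div₀, Complex.conj_ofReal]
        rw [← Complex.star_def, hherm k j]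
      rw [Matrix.sub_apply, Matrix.vecMulVec_apply, Pi.star_apply, this, hw, ← hsq]
      simp only
      rw [div_mul_div_comm]
    have hrow : ∀ i, (R - Matrix.vecMulVec w (star w)) j i = 0 := by
      intro i
      rw [hent, hre]
      field_simp
      simp
    refine ⟨w, fun i hi => by simp [hw, hi], ?_, hrow⟩
    -- Elementary column operation clearing row `j`. As that row of `R E` is already zero, `Eᴴ`
    -- fixes `R E`, so the remainder is the congruence `Eᴴ R E` and stays positive semidefinite.
    set E : Matrix (Fin n) (Fin n) ℂ := 1 - Matrix.of fun i k => if i = j then R j k / c else 0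
      with hE
    have hRE : R * E = R - Matrix.vecMulVec w (star w) := by
      ext i k
      rw [hent, hE, Matrix.mul_sub, Matrix.mul_one, Matrix.sub_apply, Matrix.mul_apply]
      simp [mul_div_assoc]
    have hER : Eᴴ * (R * E) = R * E := by
      ext i k
      rw [hRE, hE, Matrix.conjTranspose_sub, Matrix.conjTranspose_one, Matrix.sub_mul,
        Matrix.one_mul, Matrix.sub_apply, Matrix.mul_apply]
      rw [sub_eq_self]
      refine Finset.sum_eq_zero fun l _ => ?_
      rw [Matrix.conjTranspose_apply, Matrix.of_apply]
      split_ifs with h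
      · rw [h, hrow, mul_zero]
      · simp
    rw [← hRE, ← hER, ← Matrix.mul_assoc]
    exact hR.conjTranspose_mul_mul_same E

/-- A vector supported in the window of length `K + 1` that starts at `k`. -/
def InWindow {n : ℕ} (K : ℕ) (k : Fin n) (u : Fin n → ℂ) : Prop :=
  ∀ i : Fin n, ¬ (k ≤ i ∧ (i : ℕ) ≤ k + K) → u i = 0

/-- Induction on the number `d` of trailing rows not yet eliminated. The pivot column has zeros
above the pivot by earlier eliminations and zeros more than `K` below it by the band, so its vector
lies in the window; subtracting its outer product does not widen the band. -/
lemma exists_window_decomposition_aux {n : ℕ} (K d : ℕ) :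
    ∀ R : Matrix (Fin n) (Fin n) ℂ, R.PosSemidef →
      (∀ i j : Fin n, (K : ℤ) < |(i : ℤ) - (j : ℤ)| → R i j = 0) →
      (∀ i j : Fin n, (i : ℕ) + d < n → R i j = 0) →
      ∃ u : Fin n → Fin n → ℂ, (∀ k, InWindow K k (u k)) ∧
        (∀ k : Fin n, (k : ℕ) + d < n → u k = 0) ∧
        R = ∑ k, Matrix.vecMulVec (u k) (star (u k)) := by
  induction d with
  | zero =>
    intro R _ _ h0
    refine ⟨0, fun k i _ => rfl, fun k _ => rfl, ?_⟩
    ext i j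
    simp [h0 i j (by have := i.2; omega), Matrix.sum_apply]
  | succ d ih =>
    intro R hR hband hrow
    by_cases hd : d < n
    · set j : Fin n := ⟨n - (d + 1), by omega⟩ with hj
      obtain ⟨w, hw, hpsd, hwrow⟩ := posSemidef_sub_pivot hR j
      have hcol : ∀ i l : Fin n, (i : ℕ) + (d + 1) < n → R l i = 0 := by
        intro i l hi
        rw [← hR.isHermitian.apply, hrow i l hi, star_zero]
      have hwin : InWindow K j w := by
        intro i hi
        apply hw
        by_cases h1 : j ≤ i
        · apply hband
          have h2 : (j : ℕ) + K < i := by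
            by_contra hc
            exact hi ⟨h1, by omega⟩
          rw [lt_abs]; left
          omega
        · have h1' : (i : ℕ) < j := by simpa using h1
          exact hrow i j (by simp only [hj] at h1'; omega)
      obtain ⟨u, hu1, hu2, hu3⟩ := ih (R - Matrix.vecMulVec w (star w)) hpsd
        (by
          intro i l hil
          rw [Matrix.sub_apply, hband i l hil, Matrix.vecMulVec_apply, Pi.star_apply]
          by_cases hi : (j ≤ i ∧ (i : ℕ) ≤ j + K)
          · by_cases hl : (j ≤ l ∧ (l : ℕ) ≤ j + K)
            · exfalso
              have h1 : (j : ℕ) ≤ i := hi.1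
              have h2 : (j : ℕ) ≤ l := hl.1
              rcases lt_abs.1 hil with h | h <;> omega
            · simp [hwin l hl]
          · simp [hwin i hi])
        (by
          intro i l hi
          by_cases hij : i = j
          · rw [hij]; exact hwrow l
          · have : (i : ℕ) ≠ j := fun h => hij (Fin.ext h)
            have hi' : (i : ℕ) + (d + 1) < n := by simp only [hj] at this; omega
            rw [Matrix.sub_apply, hrow i l hi', Matrix.vecMulVec_apply, hw i (hrow i j hi')]
            simp)
      -- The inductive decomposition leaves slot `j` empty, so the new vector can be put there.
      have huj : u j = 0 := hu2 j (by simp only [hj]; omega)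
      refine ⟨fun k => if k = j then w else u k, fun k => ?_, fun k hk => ?_, ?_⟩
      · by_cases h : k = j
        · subst h; simpa using hwin
        · simpa [h] using hu1 k
      · have h : k ≠ j := by
          rintro rfl
          simp only [hj] at hk
          omega
        simp only [h, if_false]
        exact hu2 k (by omega)
      · have : ∀ k, Matrix.vecMulVec (if k = j then w else u k) (star (if k = j then w else u k)) =
            Matrix.vecMulVec (u k) (star (u k)) +
              if k = j then Matrix.vecMulVec w (star w) else 0 := by
          intro k
          by_cases h : k = j
          · subst h; simp [huj]
          · simp [h]
        simp_rw [this]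
        rw [Finset.sum_add_distrib, ← hu3]
        simp
    · obtain ⟨u, hu1, hu2, hu3⟩ := ih R hR hband fun i j hi => by omega
      exact ⟨u, hu1, fun k hk => hu2 k (by omega), hu3⟩

lemma exists_window_decomposition {n K : ℕ} {R : Matrix (Fin n) (Fin n) ℂ} (hR : R.PosSemidef)
    (hband : ∀ i j : Fin n, (K : ℤ) < |(i : ℤ) - (j : ℤ)| → R i j = 0) :
    ∃ U : Matrix (Fin n) (Fin n) ℂ, (∀ k, InWindow K k (fun i => U i k)) ∧ R = U * Uᴴ := by
  obtain ⟨u, hu1, -, hu3⟩ := exists_window_decomposition_aux K n R hR hband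
    fun i j hi => by omega
  refine ⟨Matrix.of fun i k => u k i, hu1, ?_⟩
  rw [hu3]
  ext i j
  simp [Matrix.sum_apply, Matrix.vecMulVec_apply, Matrix.mul_apply]

lemma band_of_inWindow {n K : ℕ} {U : Matrix (Fin n) (Fin n) ℂ}
    (hU : ∀ k, InWindow K k (fun i => U i k)) (i j : Fin n)
    (hij : (K : ℤ) < |(i : ℤ) - (j : ℤ)|) : (U * Uᴴ) i j = 0 := by
  rw [Matrix.mul_apply]
  refine Finset.sum_eq_zero fun k _ => ?_
  rw [Matrix.conjTranspose_apply]
  by_cases hi : (k ≤ i ∧ (i : ℕ) ≤ k + K)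
  · by_cases hj : (k ≤ j ∧ (j : ℕ) ≤ k + K)
    · exfalso
      have h1 : (k : ℕ) ≤ i := hi.1
      have h2 : (k : ℕ) ≤ j := hj.1
      rcases lt_abs.1 hij with h | h <;> omega
    · have : U j k = 0 := hU k j hj
      simp [this]
  · have : U i k = 0 := hU k i hi
    simp [this]

/-- Windows start at the diagonal, so `U` is lower triangular. -/
lemma det_mul_conjTranspose_of_inWindow {n K : ℕ} {U : Matrix (Fin n) (Fin n) ℂ}
    (hU : ∀ k, InWindow K k (fun i => U i k)) :
    (U * Uᴴ).det = ((∏ k, ‖U k k‖ ^ 2 : ℝ) : ℂ) := by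
  have hlow : U.det = ∏ k, U k k := by
    apply Matrix.det_of_isLowerTriangular
    intro i k hik
    exact hU k i fun h => absurd h.1 (not_le.2 hik)
  rw [Matrix.det_mul, Matrix.det_conjTranspose, hlow, Complex.ofReal_prod, star_prod,
    ← Finset.prod_mul_distrib]
  refine Finset.prod_congr rfl fun k _ => ?_
  rw [Complex.star_def, Complex.mul_conj, Complex.normSq_eq_norm_sq]

end Cholesky

/-! ### Euclidean and Frobenius norm estimates -/

/-- The squared Euclidean norm of a vector. -/
noncomputable def sqNorm {m : Type*} [Fintype m] (u : m → ℂ) : ℝ := ∑ i, ‖u i‖ ^ 2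

/-- The squared Frobenius norm of a matrix. -/
noncomputable def sqFrobenius {m n : Type*} [Fintype m] [Fintype n] (A : Matrix m n ℂ) : ℝ :=
  ∑ i, ∑ j, ‖A i j‖ ^ 2

section SqNorm

variable {m n : Type*} [Fintype m] [Fintype n]

lemma sqNorm_nonneg (u : m → ℂ) : 0 ≤ sqNorm u := Finset.sum_nonneg fun _ _ => by positivity

lemma sqFrobenius_nonneg (A : Matrix m n ℂ) : 0 ≤ sqFrobenius A :=
  Finset.sum_nonneg fun _ _ => Finset.sum_nonneg fun _ _ => by positivity

lemma norm_sq_le_sqNorm (u : m → ℂ) (i : m) : ‖u i‖ ^ 2 ≤ sqNorm u :=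
  Finset.single_le_sum (f := fun i => ‖u i‖ ^ 2) (fun _ _ => by positivity) (Finset.mem_univ i)

lemma sqNorm_mulVec_le (A : Matrix m n ℂ) (x : n → ℂ) :
    sqNorm (A *ᵥ x) ≤ sqFrobenius A * sqNorm x := by
  rw [sqFrobenius, Finset.sum_mul]
  refine Finset.sum_le_sum fun i _ => ?_
  calc ‖(A *ᵥ x) i‖ ^ 2 ≤ (∑ j, ‖A i j‖ * ‖x j‖) ^ 2 := by
        gcongr
        refine (norm_sum_le _ _).trans (le_of_eq ?_)
        simp
    _ ≤ _ := Finset.sum_mul_sq_le_sq_mul_sq _ _ _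

lemma sqNorm_le_two_mul (u v : m → ℂ) : sqNorm u ≤ 2 * (sqNorm (u - v) + sqNorm v) := by
  simp only [sqNorm]
  rw [← Finset.sum_add_distrib, Finset.mul_sum]
  refine Finset.sum_le_sum fun i _ => ?_
  have h : ‖u i‖ ≤ ‖(u - v) i‖ + ‖v i‖ := by
    simpa using norm_add_le (u i - v i) (v i)
  nlinarith [norm_nonneg (u i), sq_nonneg (‖(u - v) i‖ - ‖v i‖)]

lemma sqNorm_smul (c : ℂ) (u : m → ℂ) : sqNorm (c • u) = ‖c‖ ^ 2 * sqNorm u := by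
  simp [sqNorm, mul_pow, Finset.mul_sum]

lemma sqNorm_comp_le {T : n → m} (hT : Function.Injective T) (u : m → ℂ) :
    sqNorm (fun j => u (T j)) ≤ sqNorm u := by
  classical
  rw [sqNorm, sqNorm, ← Finset.sum_image (f := fun i => ‖u i‖ ^ 2) (hT.injOn)]
  exact Finset.sum_le_sum_of_subset_of_nonneg (Finset.subset_univ _) fun _ _ _ => by positivity

lemma sqNorm_neg (u : m → ℂ) : sqNorm (-u) = sqNorm u := by simp [sqNorm]

end SqNorm

/-! ### Bounds on the error power and on one column's rate -/

section ErrorPower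

variable {nT nR : ℕ} (H : Matrix (Fin nR) (Fin nT) ℂ) (N₀ : ℝ≥0)

/-- The mean squared error of the estimate of a linear functional of the input. -/
noncomputable def errorPower (u : Fin nT → ℂ) : ℝ := (star u ⬝ᵥ (errorCov H N₀ *ᵥ u)).re

/-- The contribution to the rate of the column `u`, with pivot `k`, of a triangular factor. -/
noncomputable def columnRate (k : Fin nT) (u : Fin nT → ℂ) : ℝ :=
  Real.log (‖u k‖ ^ 2) - errorPower H N₀ u + 1

variable {N₀}

/-- The ridge regression identity: `s = Y⁻¹ H u` is the regularized fit of `u` by the range of `Hᴴ`,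
and the error power is residual plus penalty. -/
lemma errorPower_eq (hN : 0 < N₀) (u : Fin nT → ℂ) :
    errorPower H N₀ u =
      sqNorm (u - Hᴴ *ᵥ ((outputCov H N₀)⁻¹ *ᵥ (H *ᵥ u))) +
        N₀ * sqNorm ((outputCov H N₀)⁻¹ *ᵥ (H *ᵥ u)) := by
  set s := (outputCov H N₀)⁻¹ *ᵥ (H *ᵥ u) with hs
  have hYs : outputCov H N₀ *ᵥ s = H *ᵥ u := by
    rw [hs, Matrix.mulVec_mulVec, outputCov_mul_inv H hN, Matrix.one_mulVec]
  have hYs' : (H * Hᴴ) *ᵥ s = H *ᵥ u - (N₀ : ℂ) • s := by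
    rw [← hYs, outputCov, Matrix.add_mulVec, Matrix.smul_mulVec, Matrix.one_mulVec,
      add_sub_cancel_right]
  have hcomplex : star u ⬝ᵥ (errorCov H N₀ *ᵥ u) =
      star (u - Hᴴ *ᵥ s) ⬝ᵥ (u - Hᴴ *ᵥ s) + N₀ * (star s ⬝ᵥ s) := by
    have e1 : star (Hᴴ *ᵥ s) ⬝ᵥ u = star s ⬝ᵥ (H *ᵥ u) := by
      rw [dotProduct_star_conjTranspose_mulVec, Matrix.conjTranspose_conjTranspose]
    have e2 : star (Hᴴ *ᵥ s) ⬝ᵥ (Hᴴ *ᵥ s) = star s ⬝ᵥ (H *ᵥ u) - N₀ * (star s ⬝ᵥ s) := by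
      rw [dotProduct_star_conjTranspose_mulVec, Matrix.conjTranspose_conjTranspose,
        Matrix.mulVec_mulVec, hYs', dotProduct_sub, dotProduct_smul, smul_eq_mul]
    have e3 : errorCov H N₀ *ᵥ u = u - Hᴴ *ᵥ s := by
      rw [errorCov, Matrix.sub_mulVec, Matrix.one_mulVec, hs, Matrix.mulVec_mulVec,
        Matrix.mulVec_mulVec]
    rw [e3, star_sub, sub_dotProduct, dotProduct_sub (star (Hᴴ *ᵥ s)), e1, e2]
    ring
  rw [errorPower, hcomplex, Complex.add_re, re_star_dotProduct_self]
  have : ((N₀ : ℂ) * (star s ⬝ᵥ s)).re = N₀ * sqNorm s := by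
    have h0 : (N₀ : ℂ) = ((N₀ : ℝ) : ℂ) := rfl
    rw [h0, Complex.re_ofReal_mul, re_star_dotProduct_self]
    rfl
  rw [this]
  rfl

lemma errorPower_le_sqNorm (hN : 0 < N₀) (u : Fin nT → ℂ) : errorPower H N₀ u ≤ sqNorm u := by
  have e : star u ⬝ᵥ (errorCov H N₀ *ᵥ u) =
      star u ⬝ᵥ u - star (H *ᵥ u) ⬝ᵥ ((outputCov H N₀)⁻¹ *ᵥ (H *ᵥ u)) := by
    rw [errorCov, Matrix.sub_mulVec, Matrix.one_mulVec, dotProduct_sub,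
      dotProduct_star_conjTranspose_mulVec]
    simp only [Matrix.mulVec_mulVec, Matrix.mul_assoc]
  have h := ((posDef_outputCov H hN).inv.posSemidef).re_dotProduct_nonneg (H *ᵥ u)
  rw [errorPower, e, Complex.sub_re, re_star_dotProduct_self]
  simp only [RCLike.re_eq_complex_re] at h
  simp only [sqNorm]
  linarith

/-- On the range of `Hᴴ` the error power vanishes linearly with the noise; this is the source of all
growth of the rate. -/
lemma errorPower_conjTranspose_mulVec_le (hN : 0 < N₀) (s : Fin nR → ℂ) :
    errorPower H N₀ (Hᴴ *ᵥ s) ≤ N₀ * sqNorm s := by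
  have h0 : (N₀ : ℂ) = ((N₀ : ℝ) : ℂ) := rfl
  have hHH : H * Hᴴ = outputCov H N₀ - (N₀ : ℂ) • 1 := by rw [outputCov, add_sub_cancel_right]
  have e1 : errorCov H N₀ *ᵥ (Hᴴ *ᵥ s) =
      (N₀ : ℂ) • (Hᴴ *ᵥ ((outputCov H N₀)⁻¹ *ᵥ s)) := by
    have : (outputCov H N₀)⁻¹ * (H * Hᴴ) = 1 - (N₀ : ℂ) • (outputCov H N₀)⁻¹ := by
      rw [hHH, Matrix.mul_sub, inv_mul_outputCov H hN, mul_smul_comm, Matrix.mul_one]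
    rw [errorCov, Matrix.sub_mulVec, Matrix.one_mulVec, Matrix.mulVec_mulVec, Matrix.mul_assoc,
      Matrix.mul_assoc, this, Matrix.mul_sub, Matrix.mul_one, Matrix.sub_mulVec, sub_sub_cancel,
      Matrix.mul_smul, Matrix.smul_mulVec, Matrix.mulVec_mulVec]
  have e2 : star (Hᴴ *ᵥ s) ⬝ᵥ (errorCov H N₀ *ᵥ (Hᴴ *ᵥ s)) =
      (N₀ : ℂ) * (star s ⬝ᵥ s - (N₀ : ℂ) * (star s ⬝ᵥ ((outputCov H N₀)⁻¹ *ᵥ s))) := by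
    rw [e1, dotProduct_smul, dotProduct_star_conjTranspose_mulVec,
      Matrix.conjTranspose_conjTranspose, Matrix.mulVec_mulVec, hHH, Matrix.sub_mulVec,
      Matrix.mulVec_mulVec, outputCov_mul_inv H hN, Matrix.one_mulVec, Matrix.smul_mulVec,
      Matrix.one_mulVec, dotProduct_sub, dotProduct_smul, smul_eq_mul, smul_eq_mul]
  have h := ((posDef_outputCov H hN).inv.posSemidef).re_dotProduct_nonneg s
  simp only [RCLike.re_eq_complex_re] at h
  rw [errorPower, e2, h0, Complex.re_ofReal_mul, Complex.sub_re, Complex.re_ofReal_mul,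
    re_star_dotProduct_self]
  have h1 : (0 : ℝ) ≤ N₀ := N₀.2
  refine mul_le_mul_of_nonneg_left ?_ h1
  have := mul_nonneg h1 h
  simp only [sqNorm]
  linarith

lemma errorPower_smul (c : ℂ) (u : Fin nT → ℂ) :
    errorPower H N₀ (c • u) = ‖c‖ ^ 2 * errorPower H N₀ u := by
  have : star (c • u) ⬝ᵥ (errorCov H N₀ *ᵥ (c • u)) =
      ((‖c‖ ^ 2 : ℝ) : ℂ) * (star u ⬝ᵥ (errorCov H N₀ *ᵥ u)) := by
    rw [Matrix.mulVec_smul, star_smul, smul_dotProduct, dotProduct_smul, smul_eq_mul, smul_eq_mul,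
      ← Complex.normSq_eq_norm_sq, Complex.normSq_eq_conj_mul_self, mul_assoc]
    rfl
  rw [errorPower, this, Complex.re_ofReal_mul, errorPower]

lemma sqNorm_le_mul_errorPower (hN : 0 < N₀) (u : Fin nT → ℂ) :
    sqNorm u ≤ 2 * (1 + sqFrobenius H / N₀) * errorPower H N₀ u := by
  rw [errorPower_eq H hN]
  set s := (outputCov H N₀)⁻¹ *ᵥ (H *ᵥ u)
  have hN' : (0 : ℝ) < N₀ := hN
  have h1 := sqNorm_le_two_mul u (Hᴴ *ᵥ s)
  have h2 := sqNorm_mulVec_le Hᴴ s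
  have hF : sqFrobenius Hᴴ = sqFrobenius H := by
    rw [sqFrobenius, Finset.sum_comm]
    simp [sqFrobenius, Matrix.conjTranspose_apply]
  rw [hF] at h2
  have h3 := sqNorm_nonneg (u - Hᴴ *ᵥ s)
  have h4 := sqNorm_nonneg s
  have h5 := sqFrobenius_nonneg H
  have h6 : 0 ≤ sqFrobenius H / N₀ * sqNorm (u - Hᴴ *ᵥ s) := by positivity
  have h7 : sqFrobenius H / N₀ * (N₀ * sqNorm s) = sqFrobenius H * sqNorm s := by
    field_simp
  have h8 : 0 ≤ (N₀ : ℝ) * sqNorm s := by positivity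
  nlinarith

/-- Where `u` vanishes, the residual `u - Hᴴ s` equals `-Hᴴ s`. On `nR` such coordinates with
invertible minor it therefore controls `s`, hence `Hᴴ s` and `u`. The penalty `N₀ ‖s‖²` is not
needed, so the constant does not depend on `N₀`. -/
lemma sqNorm_le_mul_errorPower_of_minor (hN : 0 < N₀) (u : Fin nT → ℂ) {T : Fin nR → Fin nT}
    (hT : Function.Injective T) (hu : ∀ j, u (T j) = 0) (hdet : (H.submatrix id T).det ≠ 0) :
    sqNorm u ≤ 2 * (1 + sqFrobenius H * sqFrobenius (H.submatrix id T).adjugate /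
      ‖(H.submatrix id T).det‖ ^ 2) * errorPower H N₀ u := by
  rw [errorPower_eq H hN]
  set s := (outputCov H N₀)⁻¹ *ᵥ (H *ᵥ u)
  set A := H.submatrix id T with hA
  have hN' : (0 : ℝ) < N₀ := hN
  have hF : ∀ {m n : ℕ} (B : Matrix (Fin m) (Fin n) ℂ), sqFrobenius Bᴴ = sqFrobenius B := by
    intro m n B
    rw [sqFrobenius, Finset.sum_comm]
    simp [sqFrobenius, Matrix.conjTranspose_apply]
  have h1 := sqNorm_le_two_mul u (Hᴴ *ᵥ s)
  have h2 := sqNorm_mulVec_le Hᴴ s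
  rw [hF] at h2
  have hAs : sqNorm (Aᴴ *ᵥ s) ≤ sqNorm (u - Hᴴ *ᵥ s) := by
    have : Aᴴ *ᵥ s = -(fun j => (u - Hᴴ *ᵥ s) (T j)) := by
      ext j
      simp [hu, hA, Matrix.mulVec, dotProduct, Matrix.conjTranspose_apply]
    rw [this, sqNorm_neg]
    exact sqNorm_comp_le hT _
  have hs : ‖A.det‖ ^ 2 * sqNorm s ≤ sqFrobenius A.adjugate * sqNorm (u - Hᴴ *ᵥ s) := by
    have e : A.adjugateᴴ *ᵥ (Aᴴ *ᵥ s) = (star A.det) • s := by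
      rw [Matrix.mulVec_mulVec, ← Matrix.conjTranspose_mul, Matrix.mul_adjugate,
        Matrix.conjTranspose_smul, Matrix.conjTranspose_one, Matrix.smul_mulVec, Matrix.one_mulVec]
    have h := sqNorm_mulVec_le A.adjugateᴴ (Aᴴ *ᵥ s)
    rw [e, sqNorm_smul, hF, norm_star] at h
    exact h.trans (mul_le_mul_of_nonneg_left hAs (sqFrobenius_nonneg _))
  have hd : 0 < ‖A.det‖ ^ 2 := by positivity
  have hs' : sqNorm s ≤ sqFrobenius A.adjugate * sqNorm (u - Hᴴ *ᵥ s) / ‖A.det‖ ^ 2 := by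
    rw [le_div_iff₀ hd, mul_comm]; exact hs
  have h3 := sqNorm_nonneg (u - Hᴴ *ᵥ s)
  have h4 := sqNorm_nonneg s
  have h5 := sqFrobenius_nonneg H
  have h6 := sqFrobenius_nonneg A.adjugate
  have h7 : sqFrobenius H * sqNorm s ≤
      sqFrobenius H * sqFrobenius A.adjugate / ‖A.det‖ ^ 2 * sqNorm (u - Hᴴ *ᵥ s) := by
    calc _ ≤ sqFrobenius H * (sqFrobenius A.adjugate * sqNorm (u - Hᴴ *ᵥ s) / ‖A.det‖ ^ 2) :=
          mul_le_mul_of_nonneg_left hs' h5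
      _ = _ := by ring
  have h8 : 0 ≤ sqFrobenius H * sqFrobenius A.adjugate / ‖A.det‖ ^ 2 * (N₀ * sqNorm s) := by
    positivity
  have h9 : 0 ≤ (N₀ : ℝ) * sqNorm s := by positivity
  nlinarith

/-- With `q` the error power, `log |u k|² ≤ log C + log q` and `log q ≤ q - 1`. Every upper bound on
a rate passes through this. -/
lemma columnRate_le_log {k : Fin nT} {u : Fin nT → ℂ} (hk : u k ≠ 0) {C : ℝ} (hC : 0 < C)
    (hu : sqNorm u ≤ C * errorPower H N₀ u) : columnRate H N₀ k u ≤ Real.log C := by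
  have h0 : 0 < ‖u k‖ ^ 2 := by positivity
  have h1 := norm_sq_le_sqNorm u k
  have hq : 0 < errorPower H N₀ u := by
    by_contra h
    have := mul_nonpos_of_nonneg_of_nonpos hC.le (not_lt.1 h)
    linarith
  have h2 := Real.log_le_log h0 (h1.trans hu)
  rw [Real.log_mul hC.ne' hq.ne'] at h2
  have h3 := Real.log_le_sub_one_of_pos hq
  rw [columnRate]
  linarith

lemma continuous_errorPower : Continuous (errorPower H N₀) := by
  unfold errorPower; fun_prop

lemma exists_isMaxOn_columnRate (hN : 0 < N₀) (K : ℕ) (k : Fin nT) :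
    ∃ u : Fin nT → ℂ, InWindow K k u ∧ u k ≠ 0 ∧
      ∀ v, InWindow K k v → v k ≠ 0 → columnRate H N₀ k v ≤ columnRate H N₀ k u := by
  -- Exponentiating extends the objective continuously by zero across `u k = 0`, so the domain
  -- becomes closed. Coercivity of the error power makes `g` tend to zero at infinity, and a
  -- maximizer with positive value has nonzero pivot.
  set g : (Fin nT → ℂ) → ℝ := fun u => ‖u k‖ ^ 2 * Real.exp (-errorPower H N₀ u) with hg
  have hgc : Continuous g := by
    have := continuous_errorPower H (N₀ := N₀)
    fun_prop
  have hclosed : IsClosed {u : Fin nT → ℂ | InWindow K k u} := by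
    simp only [InWindow, Set.ofPred_forall]
    refine isClosed_iInter fun i => isClosed_iInter fun _ => ?_
    exact isClosed_eq (continuous_apply i) continuous_const
  set e : Fin nT → ℂ := Pi.single k 1 with he
  have hek : e k = 1 := by simp [he]
  have hew : InWindow K k e := by
    intro i hi
    have : i ≠ k := by rintro rfl; exact hi ⟨le_rfl, by omega⟩
    simp [he, this]
  have hge : 0 < g e := by simp [hg, hek, Real.exp_pos]
  set C : ℝ := 2 * (1 + sqFrobenius H / N₀) with hC
  have hCpos : 0 < C := by
    have := sqFrobenius_nonneg H
    have hN' : (0 : ℝ) < N₀ := hN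
    positivity
  have hbound : ∀ u, g u ≤ C * ((sqNorm u / C) * Real.exp (-(sqNorm u / C))) := by
    intro u
    have h1 := norm_sq_le_sqNorm u k
    have h2 : sqNorm u / C ≤ errorPower H N₀ u := by
      rw [div_le_iff₀ hCpos, mul_comm]
      exact sqNorm_le_mul_errorPower H hN u
    rw [← mul_assoc, mul_div_cancel₀ _ hCpos.ne']
    exact mul_le_mul h1 (Real.exp_le_exp.2 (neg_le_neg h2)) (Real.exp_nonneg _) (sqNorm_nonneg u)
  have hinf : Tendsto (fun u : Fin nT → ℂ => sqNorm u / C) (cocompact _) atTop := by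
    have h1 : Tendsto (fun u : Fin nT → ℂ => ‖u‖ ^ 2 / C) (cocompact _) atTop :=
      ((tendsto_pow_atTop two_ne_zero).comp tendsto_norm_cocompact_atTop).atTop_div_const hCpos
    refine tendsto_atTop_mono (fun u => ?_) h1
    gcongr
    have h2 : ‖u‖ ≤ √(sqNorm u) := by
      rw [pi_norm_le_iff_of_nonneg (Real.sqrt_nonneg _)]
      exact fun i => Real.le_sqrt_of_sq_le (norm_sq_le_sqNorm u i)
    calc ‖u‖ ^ 2 ≤ √(sqNorm u) ^ 2 := by gcongr
      _ = _ := Real.sq_sqrt (sqNorm_nonneg u)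
  have hlim : Tendsto (fun t : ℝ => C * (t * Real.exp (-t))) atTop (𝓝 0) := by
    have := (Real.tendsto_pow_mul_exp_neg_atTop_nhds_zero 1).const_mul C
    simpa using this
  have hev : ∀ᶠ u in cocompact (Fin nT → ℂ) ⊓ 𝓟 {u | InWindow K k u}, g u ≤ g e := by
    refine Eventually.filter_mono inf_le_left ?_
    filter_upwards [(hlim.comp hinf).eventually (gt_mem_nhds hge)] with u hu
    exact (hbound u).trans hu.le
  obtain ⟨u, hu, hmax⟩ := hgc.continuousOn.exists_isMaxOn' hclosed (x₀ := e) hew hev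
  have hgu : 0 < g u := hge.trans_le (hmax hew)
  have huk : u k ≠ 0 := by
    intro h
    simp [hg, h] at hgu
  refine ⟨u, hu, huk, fun v hv hvk => ?_⟩
  have hlog : ∀ w : Fin nT → ℂ, w k ≠ 0 → columnRate H N₀ k w = Real.log (g w) + 1 := by
    intro w hw
    have : ‖w k‖ ^ 2 ≠ 0 := by positivity
    rw [columnRate, hg, Real.log_mul this (Real.exp_ne_zero _), Real.log_exp]
    ring
  rw [hlog v hvk, hlog u huk]
  have hgv : 0 < g v := by
    have : 0 < ‖v k‖ ^ 2 := by positivity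
    simp only [hg]
    positivity
  have := Real.log_le_log hgv (hmax hv)
  linarith

end ErrorPower

/-! ### Decoupling the optimization into columns -/

section OptimizedRate

variable {nT nR K : ℕ} (H : Matrix (Fin nR) (Fin nT) ℂ) {N₀ : ℝ≥0}

lemma sum_columnRate {U : Matrix (Fin nT) (Fin nT) ℂ}
    (hU : ∀ k, InWindow K k (fun i => U i k)) (hU0 : ∀ k, U k k ≠ 0) :
    Real.log (U * Uᴴ).det.re - ((U * Uᴴ) * errorCov H N₀).trace.re + nT =
      ∑ k, columnRate H N₀ k (fun i => U i k) := by
  have htr : ((U * Uᴴ) * errorCov H N₀).trace.re = ∑ k, errorPower H N₀ (fun i => U i k) := by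
    rw [Matrix.mul_assoc, Matrix.trace_mul_comm, Matrix.trace, Complex.re_sum]
    refine Finset.sum_congr rfl fun k _ => ?_
    rw [errorPower, Matrix.diag_apply, Matrix.mul_assoc, Matrix.mul_apply]
    rfl
  rw [det_mul_conjTranspose_of_inWindow hU, Complex.ofReal_re, htr,
    Real.log_prod (fun k _ => by have := hU0 k; positivity)]
  simp only [columnRate]
  rw [Finset.sum_add_distrib, Finset.sum_sub_distrib]
  simp

/-- Factor `1 + Gr` and drop the nonnegative front-end loss. Positive definiteness excludes zero
pivots through the determinant. -/
lemma Receiver.exists_gmi_le_sum_columnRate (hN : 0 < N₀) (r : Receiver nT nR K)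
    (hr : (1 + r.Gr).PosDef) :
    ∃ u : Fin nT → Fin nT → ℂ, (∀ k, InWindow K k (u k)) ∧ (∀ k, u k k ≠ 0) ∧
      r.gmi H N₀ ≤ ((∑ k, columnRate H N₀ k (u k) : ℝ) : EReal) := by
  obtain ⟨U, hU, hMU⟩ := exists_window_decomposition (K := K) hr.posSemidef (by
    intro i j hij
    have hne : i ≠ j := by
      rintro rfl
      simp at hij
      omega
    rw [Matrix.add_apply, Matrix.one_apply_ne hne, r.banded i j hij, add_zero])
  have hdet := (Complex.lt_def.1 hr.det_pos).1
  have hU0 : ∀ k, U k k ≠ 0 := by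
    intro k hk
    rw [hMU, det_mul_conjTranspose_of_inWindow hU, Complex.ofReal_re,
      Finset.prod_eq_zero (Finset.mem_univ k) (by simp [hk])] at hdet
    simp at hdet
  refine ⟨fun k i => U i k, hU, hU0, ?_⟩
  rw [r.gmi_eq_of_posDef hr, EReal.coe_le_coe_iff, r.gmiReal_eq hr H hN,
    ← sum_columnRate H hU hU0, ← hMU]
  have := re_trace_conjTranspose_mul_mul_outputCov_nonneg H (N₀ := N₀) hr.inv.posSemidef
    (r.Hr - (1 + r.Gr) * Hᴴ * (outputCov H N₀)⁻¹)
  linarith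

/-- The columns assemble into `Gr = U Uᴴ - 1`, and the optimal front end for this `Gr` makes the
loss zero. -/
lemma Receiver.exists_gmi_eq_sum_columnRate (hN : 0 < N₀) {u : Fin nT → Fin nT → ℂ}
    (hu : ∀ k, InWindow K k (u k)) (hu0 : ∀ k, u k k ≠ 0) :
    ∃ r : Receiver nT nR K, r.gmi H N₀ = ((∑ k, columnRate H N₀ k (u k) : ℝ) : EReal) := by
  set U : Matrix (Fin nT) (Fin nT) ℂ := Matrix.of fun i k => u k i with hU
  have huU : ∀ k, InWindow K k (fun i => U i k) := hu
  have hherm : (U * Uᴴ - 1).IsHermitian :=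
    (Matrix.isHermitian_mul_conjTranspose_self U).sub Matrix.isHermitian_one
  let r : Receiver nT nR K :=
    { Hr := U * Uᴴ * Hᴴ * (outputCov H N₀)⁻¹
      Gr := U * Uᴴ - 1
      isHermitian := hherm
      banded := by
        intro i j hij
        have hne : i ≠ j := by
          rintro rfl
          simp at hij
          omega
        rw [Matrix.sub_apply, band_of_inWindow huU i j hij, Matrix.one_apply_ne hne,
          sub_zero] }
  have hG : 1 + r.Gr = U * Uᴴ := by simp [r]
  have hdet : (U * Uᴴ).det ≠ 0 := by
    rw [det_mul_conjTranspose_of_inWindow huU, Complex.ofReal_ne_zero]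
    refine Finset.prod_ne_zero_iff.2 fun k _ => ?_
    have : U k k ≠ 0 := hu0 k
    positivity
  have hpd : (1 + r.Gr).PosDef := by
    rw [hG]
    refine Matrix.PosDef.mul_conjTranspose_self U ?_
    rw [Matrix.vecMul_injective_iff_isUnit, Matrix.isUnit_iff_isUnit_det, isUnit_iff_ne_zero]
    intro h
    rw [Matrix.det_mul, h, zero_mul] at hdet
    exact hdet rfl
  refine ⟨r, ?_⟩
  have hHr : r.Hr = U * Uᴴ * Hᴴ * (outputCov H N₀)⁻¹ := rfl
  rw [r.gmi_eq_of_posDef hpd, EReal.coe_eq_coe_iff, r.gmiReal_eq hpd H hN, hG, hHr, sub_self]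
  have := sum_columnRate H (N₀ := N₀) huU hu0
  rw [this]
  simp [hU]

lemma exists_optimal_columns (K : ℕ) (hN : 0 < N₀) :
    ∃ u : Fin nT → Fin nT → ℂ, (∀ k, InWindow K k (u k)) ∧ (∀ k, u k k ≠ 0) ∧
      (∀ k v, InWindow K k v → v k ≠ 0 → columnRate H N₀ k v ≤ columnRate H N₀ k (u k)) ∧
      IsGreatest (Set.range fun r : Receiver nT nR K => r.gmi H N₀)
        ((∑ k, columnRate H N₀ k (u k) : ℝ) : EReal) ∧
      optimizedRate K H N₀ = ∑ k, columnRate H N₀ k (u k) := by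
  choose u hu hu0 hmax using exists_isMaxOn_columnRate H hN K
  have hgr : IsGreatest (Set.range fun r : Receiver nT nR K => r.gmi H N₀)
      ((∑ k, columnRate H N₀ k (u k) : ℝ) : EReal) := by
    refine ⟨Receiver.exists_gmi_eq_sum_columnRate H hN hu hu0, ?_⟩
    rintro _ ⟨r, rfl⟩
    by_cases hr : (1 + r.Gr).PosDef
    · obtain ⟨v, hv, hv0, hle⟩ := r.exists_gmi_le_sum_columnRate H hN hr
      refine hle.trans ?_
      rw [EReal.coe_le_coe_iff]
      exact Finset.sum_le_sum fun k _ => hmax k (v k) (hv k) (hv0 k)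
    · simp only [r.gmi_eq_bot hr]
      exact bot_le
  refine ⟨u, hu, hu0, hmax, hgr, ?_⟩
  rw [optimizedRate, iSup, hgr.isLUB.sSup_eq, EReal.toReal_coe]

lemma isGreatest_optimizedRate (K : ℕ) (hN : 0 < N₀) :
    IsGreatest (Set.range fun r : Receiver nT nR K => r.gmi H N₀)
      ((optimizedRate K H N₀ : ℝ) : EReal) := by
  obtain ⟨u, -, -, -, hgr, heq⟩ := exists_optimal_columns H K hN
  rw [heq]; exact hgr

lemma optimizedRate_le (hN : 0 < N₀) {c : Fin nT → ℝ}
    (hc : ∀ k v, InWindow K k v → v k ≠ 0 → columnRate H N₀ k v ≤ c k) :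
    optimizedRate K H N₀ ≤ ∑ k, c k := by
  obtain ⟨u, hu, hu0, -, -, heq⟩ := exists_optimal_columns H K hN
  rw [heq]
  exact Finset.sum_le_sum fun k _ => hc k (u k) (hu k) (hu0 k)

lemma le_optimizedRate (hN : 0 < N₀) {c : Fin nT → ℝ}
    (hc : ∀ k, ∃ v, InWindow K k v ∧ v k ≠ 0 ∧ c k ≤ columnRate H N₀ k v) :
    ∑ k, c k ≤ optimizedRate K H N₀ := by
  obtain ⟨u, -, -, hmax, -, heq⟩ := exists_optimal_columns H K hN
  rw [heq]
  refine Finset.sum_le_sum fun k _ => ?_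
  obtain ⟨v, hv, hv0, hle⟩ := hc k
  exact hle.trans (hmax k v hv hv0)

end OptimizedRate

/-! ### Integrability of the logarithm of a polynomial in Gaussian variables -/

section NegLog

/-- The negative part of the logarithm, with value `∞` at `0`. -/
noncomputable def negLog (x : ℝ) : ℝ≥0∞ := if x = 0 then ⊤ else ENNReal.ofReal (-Real.log x)

lemma measurable_negLog : Measurable negLog :=
  Measurable.ite (measurableSet_singleton 0) measurable_const (by fun_prop)

lemma negLog_mul_le (x y : ℝ) : negLog (x * y) ≤ negLog x + negLog y := by
  by_cases hx : x = 0
  · simp [negLog, hx]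
  by_cases hy : y = 0
  · simp [negLog, hy]
  simp only [negLog, hx, hy, mul_eq_zero, or_self, if_false]
  rw [Real.log_mul hx hy, neg_add]
  exact ENNReal.ofReal_add_le

lemma negLog_anti {x y : ℝ} (hx : 0 ≤ x) (hxy : x ≤ y) : negLog y ≤ negLog x := by
  by_cases h : x = 0
  · simp [negLog, h]
  have hx' : 0 < x := lt_of_le_of_ne hx (Ne.symm h)
  have hy : y ≠ 0 := (hx'.trans_le hxy).ne'
  simp only [negLog, h, hy, if_false]
  exact ENNReal.ofReal_le_ofReal (neg_le_neg (Real.log_le_log hx' hxy))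

lemma lintegral_negLog_abs_lt_top : ∫⁻ t : ℝ, negLog |t| < ⊤ := by
  have hint : IntegrableOn Real.log (Set.Ioc (-1) 1) := by
    have := intervalIntegral.intervalIntegrable_log' (a := -1) (b := 1)
    rwa [intervalIntegrable_iff_integrableOn_Ioc_of_le (by norm_num)] at this
  calc ∫⁻ t : ℝ, negLog |t| ≤ ∫⁻ t : ℝ, (Set.Ioc (-1 : ℝ) 1).indicator (fun t => ‖Real.log t‖ₑ) t := by
        apply lintegral_mono_ae
        have h0 : ∀ᵐ t : ℝ, t ≠ 0 := by simp [ae_iff]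
        filter_upwards [h0] with t ht
        rw [negLog, if_neg (abs_ne_zero.2 ht), Real.log_abs]
        by_cases h : t ∈ Set.Ioc (-1 : ℝ) 1
        · rw [Set.indicator_of_mem h, ← ofReal_norm]
          exact ENNReal.ofReal_le_ofReal (neg_le_abs _)
        · rw [Set.indicator_of_notMem h, nonpos_iff_eq_zero, ENNReal.ofReal_eq_zero, neg_nonpos,
            ← Real.log_abs]
          apply Real.log_nonneg
          simp only [Set.mem_Ioc, not_and_or, not_lt, not_le] at h
          rcases h with h | h
          · exact le_abs.2 (Or.inr (by linarith))
          · exact le_abs.2 (Or.inl h.le)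
    _ = ∫⁻ t in Set.Ioc (-1 : ℝ) 1, ‖Real.log t‖ₑ := lintegral_indicator measurableSet_Ioc _
    _ < ⊤ := hint.2

lemma lintegral_negLog_sub_gaussianReal_le (a : ℝ) :
    ∫⁻ t, negLog |t - a| ∂gaussianReal 0 (1 / 2) ≤ ∫⁻ t : ℝ, negLog |t| := by
  have hne : (1 / 2 : ℝ≥0) ≠ 0 := by norm_num
  have hm : Measurable fun t : ℝ => negLog |t - a| :=
    measurable_negLog.comp (by fun_prop)
  rw [gaussianReal_of_var_ne_zero _ hne,
    lintegral_withDensity_eq_lintegral_mul _ (measurable_gaussianPDF _ _) hm,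
    ← lintegral_sub_right_eq_self (fun t : ℝ => negLog |t|) a]
  -- At variance `1 / 2` the density is at most `1 / √π ≤ 1`, so Lebesgue measure dominates,
  -- uniformly in the shift `a`.
  refine lintegral_mono fun t => ?_
  rw [Pi.mul_apply]
  refine mul_le_of_le_one_left (zero_le) ?_
  rw [gaussianPDF, ENNReal.ofReal_le_one, gaussianPDFReal]
  refine mul_le_one₀ (inv_le_one_of_one_le₀ ?_) (Real.exp_nonneg _) ?_
  · rw [Real.one_le_sqrt]
    have := Real.pi_gt_three
    push_cast
    linarith
  · rw [Real.exp_le_one_iff]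
    refine div_nonpos_of_nonpos_of_nonneg ?_ (by positivity)
    rw [neg_nonpos]
    positivity

lemma lintegral_negLog_sub_complexGaussian_le (a : ℂ) :
    ∫⁻ z, negLog ‖z - a‖ ∂complexGaussian 1 ≤ ∫⁻ t : ℝ, negLog |t| := by
  refine le_trans ?_ (lintegral_negLog_sub_gaussianReal_le a.re)
  have hm : Measurable fun t : ℝ => negLog |t - a.re| :=
    measurable_negLog.comp (by fun_prop)
  rw [complexGaussian, lintegral_map_equiv]
  calc _ ≤ ∫⁻ p : ℝ × ℝ, negLog |p.1 - a.re|
        ∂(gaussianReal 0 (1 / 2)).prod (gaussianReal 0 (1 / 2)) := by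
        refine lintegral_mono fun p => negLog_anti (abs_nonneg _) ?_
        rw [measurableEquivRealProd_symm_apply']
        simpa using Complex.abs_re_le_norm ((⟨p.1, p.2⟩ : ℂ) - a)
    _ = _ := measurePreserving_fst.lintegral_comp hm

/-- Split off one root at a time: each linear factor costs at most a universal constant, so the
bound depends only on the degree and the leading coefficient, not on where the roots are. -/
lemma lintegral_negLog_eval_le (d : ℕ) : ∀ p : Polynomial ℂ, p.natDegree = d → p ≠ 0 →
    ∫⁻ z, negLog ‖p.eval z‖ ∂complexGaussian 1 ≤
      negLog ‖p.leadingCoeff‖ + d * ∫⁻ t : ℝ, negLog |t| := by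
  induction d with
  | zero =>
    intro p hp _
    rw [Polynomial.eq_C_of_natDegree_eq_zero hp]
    simp
  | succ d ih =>
    intro p hp hp0
    have hdeg : p.degree ≠ 0 := by
      rw [Polynomial.degree_eq_natDegree hp0, hp]
      exact_mod_cast d.succ_ne_zero
    obtain ⟨a, ha⟩ := IsAlgClosed.exists_root p hdeg
    obtain ⟨q, rfl⟩ := Polynomial.dvd_iff_isRoot.2 ha
    have hq0 : q ≠ 0 := right_ne_zero_of_mul hp0
    have hqd : q.natDegree = d := by
      rw [Polynomial.natDegree_mul (Polynomial.X_sub_C_ne_zero a) hq0,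
        Polynomial.natDegree_X_sub_C] at hp
      omega
    have hlead : ((Polynomial.X - Polynomial.C a) * q).leadingCoeff = q.leadingCoeff := by
      rw [Polynomial.leadingCoeff_mul, Polynomial.leadingCoeff_X_sub_C, one_mul]
    have hm : Measurable fun z : ℂ => negLog ‖z - a‖ := measurable_negLog.comp (by fun_prop)
    rw [hlead]
    calc ∫⁻ z, negLog ‖((Polynomial.X - Polynomial.C a) * q).eval z‖ ∂complexGaussian 1
        ≤ ∫⁻ z, (negLog ‖z - a‖ + negLog ‖q.eval z‖) ∂complexGaussian 1 := by
          refine lintegral_mono fun z => ?_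
          rw [Polynomial.eval_mul, norm_mul]
          simpa using negLog_mul_le ‖z - a‖ ‖q.eval z‖
      _ = ∫⁻ z, negLog ‖z - a‖ ∂complexGaussian 1 + ∫⁻ z, negLog ‖q.eval z‖ ∂complexGaussian 1 :=
          lintegral_add_left hm _
      _ ≤ (∫⁻ t : ℝ, negLog |t|) + (negLog ‖q.leadingCoeff‖ + d * ∫⁻ t : ℝ, negLog |t|) :=
          add_le_add (lintegral_negLog_sub_complexGaussian_le a) (ih q hqd hq0)
      _ = _ := by push_cast; ring

/-- The degree can drop only if `f` kills the leading coefficient, and then the right side is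
infinite. -/
lemma lintegral_negLog_eval_map_le {R : Type*} [CommRing R] (f : R →+* ℂ) (p : Polynomial R) :
    ∫⁻ z, negLog ‖(p.map f).eval z‖ ∂complexGaussian 1 ≤
      negLog ‖f p.leadingCoeff‖ + p.natDegree * ∫⁻ t : ℝ, negLog |t| := by
  by_cases h : f p.leadingCoeff = 0
  · simp [negLog, h]
  · have hd := Polynomial.natDegree_map_of_leadingCoeff_ne_zero f h
    have h0 : p.map f ≠ 0 := by
      intro h2
      apply h
      rw [Polynomial.leadingCoeff, ← Polynomial.coeff_map, h2, Polynomial.coeff_zero]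
    have := lintegral_negLog_eval_le _ (p.map f) hd h0
    rwa [Polynomial.leadingCoeff_map_of_leadingCoeff_ne_zero f h] at this

/-- Integrate out the first variable: what remains is the same integral for the leading coefficient,
a nonzero polynomial in one variable fewer. -/
lemma lintegral_negLog_mvPolynomial_lt_top (n : ℕ) : ∀ p : MvPolynomial (Fin n) ℂ, p ≠ 0 →
    ∫⁻ x, negLog ‖MvPolynomial.eval x p‖ ∂complexGaussianVec n 1 < ⊤ := by
  induction n with
  | zero =>
    intro p hp
    obtain ⟨a, rfl⟩ := MvPolynomial.C_surjective (Fin 0) p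
    have ha : a ≠ 0 := by rintro rfl; simp at hp
    simp [negLog, ha]
  | succ n ih =>
    intro p hp
    set q := MvPolynomial.finSuccEquiv ℂ n p with hq
    have hq0 : q ≠ 0 := by
      rw [hq]
      exact (EmbeddingLike.map_ne_zero_iff).2 hp
    have hm : Measurable fun x : Fin (n + 1) → ℂ => negLog ‖MvPolynomial.eval x p‖ :=
      measurable_negLog.comp p.continuous_eval.norm.measurable
    have hpres := (measurePreserving_piFinSuccAbove
      (fun _ : Fin (n + 1) => complexGaussian 1) 0).symm
    have h1 := hpres.lintegral_comp hm
    have hcoe : ∀ z : ℂ × (Fin n → ℂ),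
        (MeasurableEquiv.piFinSuccAbove (fun _ : Fin (n + 1) => ℂ) 0).symm z =
          Fin.cons z.1 z.2 := by
      intro z
      simp [MeasurableEquiv.piFinSuccAbove_symm_apply, Fin.insertNthEquiv]
    have hm2 : Measurable fun z : ℂ × (Fin n → ℂ) => negLog ‖MvPolynomial.eval
        ((MeasurableEquiv.piFinSuccAbove (fun _ : Fin (n + 1) => ℂ) 0).symm z) p‖ :=
      hm.comp (MeasurableEquiv.measurable _)
    rw [complexGaussianVec, ← h1, lintegral_prod_symm _ hm2.aemeasurable]
    simp_rw [hcoe, MvPolynomial.eval_eq_eval_mv_eval']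
    calc _ ≤ ∫⁻ y, (negLog ‖MvPolynomial.eval y q.leadingCoeff‖ +
          q.natDegree * ∫⁻ t : ℝ, negLog |t|) ∂complexGaussianVec n 1 :=
          lintegral_mono fun y => lintegral_negLog_eval_map_le (MvPolynomial.eval y) q
      _ = (∫⁻ y, negLog ‖MvPolynomial.eval y q.leadingCoeff‖ ∂complexGaussianVec n 1) +
          q.natDegree * ∫⁻ t : ℝ, negLog |t| := by
          rw [lintegral_add_right _ measurable_const, lintegral_const]
          simp
      _ < ⊤ := ENNReal.add_lt_top.2 ⟨ih _ (Polynomial.leadingCoeff_ne_zero.2 hq0),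
          ENNReal.mul_lt_top (by simp) lintegral_negLog_abs_lt_top⟩

end NegLog

/-! ### Log-integrable functions of the channel matrix -/

section Channel

variable {nT nR : ℕ}

lemma measurePreserving_uncurry_channelMatrixLaw :
    MeasurePreserving (MeasurableEquiv.curry (Fin nR) (Fin nT) ℂ).symm (channelMatrixLaw nR nT)
      (Measure.pi fun _ : Fin nR × Fin nT => complexGaussian 1) := by
  refine ⟨MeasurableEquiv.measurable _, ?_⟩
  have := Measure.infinitePi_map_curry_symm
    (fun (_ : Fin nR) (_ : Fin nT) => complexGaussian 1)
  rw [Measure.infinitePi_eq_pi] at this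
  simp_rw [Measure.infinitePi_eq_pi] at this
  exact this

/-- The value of a polynomial in the entries of the channel matrix. -/
noncomputable def entryEval (p : MvPolynomial (Fin nR × Fin nT) ℂ) (h : Fin nR → Fin nT → ℂ) : ℂ :=
  MvPolynomial.eval (fun q => h q.1 q.2) p

lemma continuous_entryEval (p : MvPolynomial (Fin nR × Fin nT) ℂ) : Continuous (entryEval p) := by
  have h := p.continuous_eval
  exact h.comp (by fun_prop)

lemma lintegral_negLog_entryEval_lt_top {p : MvPolynomial (Fin nR × Fin nT) ℂ} (hp : p ≠ 0) :
    ∫⁻ h, negLog ‖entryEval p h‖ ∂channelMatrixLaw nR nT < ⊤ := by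
  set e := Fintype.equivFin (Fin nR × Fin nT) with he
  have hm : Measurable fun x : Fin nR × Fin nT → ℂ => negLog ‖MvPolynomial.eval x p‖ :=
    measurable_negLog.comp p.continuous_eval.norm.measurable
  have h1 := (measurePreserving_uncurry_channelMatrixLaw (nT := nT) (nR := nR)).lintegral_comp hm
  have h2 := (measurePreserving_piCongrLeft (fun _ : Fin nR × Fin nT => complexGaussian 1)
    e.symm).lintegral_comp hm
  have hren : MvPolynomial.rename e p ≠ 0 := by
    rw [Ne, map_eq_zero_iff _ (MvPolynomial.rename_injective e e.injective)]
    exact hp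
  have h3 := lintegral_negLog_mvPolynomial_lt_top _ (MvPolynomial.rename e p) hren
  change ∫⁻ h, negLog ‖MvPolynomial.eval
    ((MeasurableEquiv.curry (Fin nR) (Fin nT) ℂ).symm h) p‖ ∂channelMatrixLaw nR nT < ⊤
  rw [h1, ← h2]
  refine lt_of_eq_of_lt ?_ h3
  rw [complexGaussianVec]
  refine lintegral_congr fun x => ?_
  rw [MvPolynomial.eval_rename]
  congr 4
  ext i
  simp [MeasurableEquiv.piCongrLeft, Equiv.piCongrLeft_apply]

/-- `negLog` is infinite at zero, so its finite integral already excludes zeros almost surely. -/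
lemma ae_entryEval_ne_zero {p : MvPolynomial (Fin nR × Fin nT) ℂ} (hp : p ≠ 0) :
    ∀ᵐ h ∂channelMatrixLaw nR nT, entryEval p h ≠ 0 := by
  have hm : Measurable fun h : Fin nR → Fin nT → ℂ => negLog ‖entryEval p h‖ :=
    measurable_negLog.comp (continuous_entryEval p).norm.measurable
  filter_upwards [ae_lt_top hm (lintegral_negLog_entryEval_lt_top hp).ne] with h hh h0
  simp [negLog, h0] at hh

/-- A nonnegative measurable function of the channel matrix with integrable `log (1 + f)`. -/
structure LogIntegrable (f : (Fin nR → Fin nT → ℂ) → ℝ) : Prop where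
  nonneg : ∀ h, 0 ≤ f h
  measurable : Measurable f
  integrable : Integrable (fun h => Real.log (1 + f h)) (channelMatrixLaw nR nT)

namespace LogIntegrable

variable {f g : (Fin nR → Fin nT → ℂ) → ℝ}

lemma of_log_le (hf0 : ∀ h, 0 ≤ f h) (hfm : Measurable f) {b : (Fin nR → Fin nT → ℂ) → ℝ}
    (hb : Integrable b (channelMatrixLaw nR nT)) (hle : ∀ h, Real.log (1 + f h) ≤ b h) :
    LogIntegrable f := by
  refine ⟨hf0, hfm, hb.mono' (Real.measurable_log.comp
    (measurable_const.add hfm)).aestronglyMeasurable (ae_of_all _ fun h => ?_)⟩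
  rw [Real.norm_of_nonneg (Real.log_nonneg (by linarith [hf0 h]))]
  exact hle h

lemma mono (hg : LogIntegrable g) (hf0 : ∀ h, 0 ≤ f h) (hfm : Measurable f)
    (hle : ∀ h, f h ≤ g h) : LogIntegrable f :=
  of_log_le hf0 hfm hg.integrable fun h =>
    Real.log_le_log (by linarith [hf0 h]) (by linarith [hle h])

/-- Both `1 + f + g` and, in the next lemma, `1 + f g` are at most `(1 + f) (1 + g)`. -/
lemma add (hf : LogIntegrable f) (hg : LogIntegrable g) : LogIntegrable fun h => f h + g h :=
  of_log_le (fun h => add_nonneg (hf.nonneg h) (hg.nonneg h)) (hf.measurable.add hg.measurable)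
    (hf.integrable.add hg.integrable) fun h => by
      have h1 := hf.nonneg h
      have h2 := hg.nonneg h
      simp only [Pi.add_apply]
      rw [← Real.log_mul (by positivity) (by positivity)]
      exact Real.log_le_log (by positivity) (by nlinarith)

lemma mul (hf : LogIntegrable f) (hg : LogIntegrable g) : LogIntegrable fun h => f h * g h :=
  of_log_le (fun h => mul_nonneg (hf.nonneg h) (hg.nonneg h)) (hf.measurable.mul hg.measurable)
    (hf.integrable.add hg.integrable) fun h => by
      have h1 := hf.nonneg h
      have h2 := hg.nonneg h
      have := mul_nonneg h1 h2
      simp only [Pi.add_apply]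
      rw [← Real.log_mul (by positivity) (by positivity)]
      exact Real.log_le_log (by positivity) (by nlinarith)

lemma const {c : ℝ} (hc : 0 ≤ c) : LogIntegrable fun _ : Fin nR → Fin nT → ℂ => c :=
  ⟨fun _ => hc, measurable_const, integrable_const _⟩

lemma sum {ι : Type*} (s : Finset ι) {F : ι → (Fin nR → Fin nT → ℂ) → ℝ}
    (hF : ∀ i, LogIntegrable (F i)) : LogIntegrable fun h => ∑ i ∈ s, F i h := by
  classical
  induction s using Finset.induction_on with
  | empty => simpa using const le_rfl
  | insert a s ha ih =>
    simp_rw [Finset.sum_insert ha]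
    exact (hF a).add ih

end LogIntegrable

lemma logIntegrable_norm_entry (i : Fin nR) (j : Fin nT) :
    LogIntegrable fun h : Fin nR → Fin nT → ℂ => ‖h i j‖ := by
  have h1 : Integrable (fun z : ℂ => ‖z‖) (complexGaussian 1) :=
    ((memLp_id_complexGaussian 1).integrable (by norm_num)).norm
  have h2 : Integrable (fun x : Fin nT → ℂ => ‖x j‖)
      (Measure.pi fun _ : Fin nT => complexGaussian 1) :=
    integrable_comp_eval (μ := fun _ : Fin nT => complexGaussian 1) (f := fun z : ℂ => ‖z‖) h1
  have h3 : Integrable (fun h : Fin nR → Fin nT → ℂ => ‖h i j‖) (channelMatrixLaw nR nT) :=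
    integrable_comp_eval (μ := fun _ : Fin nR => Measure.pi fun _ : Fin nT => complexGaussian 1)
      (f := fun x : Fin nT → ℂ => ‖x j‖) h2
  refine LogIntegrable.of_log_le (fun h => norm_nonneg _) (by fun_prop) h3 fun h => ?_
  have := Real.log_le_sub_one_of_pos (x := 1 + ‖h i j‖) (by positivity)
  linarith

lemma logIntegrable_norm_entryEval (p : MvPolynomial (Fin nR × Fin nT) ℂ) :
    LogIntegrable fun h => ‖entryEval p h‖ := by
  induction p using MvPolynomial.induction_on with
  | C a => simpa [entryEval] using LogIntegrable.const (norm_nonneg a)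
  | add p q hp hq =>
    refine (hp.add hq).mono (fun h => norm_nonneg _) (continuous_entryEval _).norm.measurable
      fun h => ?_
    simpa [entryEval] using norm_add_le (entryEval p h) (entryEval q h)
  | mul_X p i hp => simpa [entryEval] using hp.mul (logIntegrable_norm_entry i.1 i.2)

lemma logIntegrable_norm_sq_entryEval (p : MvPolynomial (Fin nR × Fin nT) ℂ) :
    LogIntegrable fun h => ‖entryEval p h‖ ^ 2 := by
  simp_rw [sq]
  exact (logIntegrable_norm_entryEval p).mul (logIntegrable_norm_entryEval p)

lemma integrable_log_norm_entryEval {p : MvPolynomial (Fin nR × Fin nT) ℂ} (hp : p ≠ 0) :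
    Integrable (fun h => Real.log ‖entryEval p h‖) (channelMatrixLaw nR nT) := by
  have hm : Measurable fun h : Fin nR → Fin nT → ℂ => ‖entryEval p h‖ :=
    (continuous_entryEval p).norm.measurable
  refine ⟨(Real.measurable_log.comp hm).aestronglyMeasurable, ?_⟩
  have hlog := (logIntegrable_norm_entryEval p).integrable
  have h1 : ∫⁻ h, ‖Real.log (1 + ‖entryEval p h‖)‖ₑ ∂channelMatrixLaw nR nT < ⊤ := hlog.2
  calc ∫⁻ h, ‖Real.log ‖entryEval p h‖‖ₑ ∂channelMatrixLaw nR nT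
      ≤ ∫⁻ h, (‖Real.log (1 + ‖entryEval p h‖)‖ₑ + negLog ‖entryEval p h‖)
          ∂channelMatrixLaw nR nT := by
        refine lintegral_mono fun h => ?_
        by_cases h0 : ‖entryEval p h‖ = 0
        · simp [negLog, h0]
        have hpos : 0 < ‖entryEval p h‖ := lt_of_le_of_ne (norm_nonneg _) (Ne.symm h0)
        rcases le_total 0 (Real.log ‖entryEval p h‖) with hl | hl
        · refine le_add_right ?_
          rw [← ofReal_norm, ← ofReal_norm]
          refine ENNReal.ofReal_le_ofReal ?_
          have h2 := Real.log_le_log hpos (by linarith : ‖entryEval p h‖ ≤ 1 + ‖entryEval p h‖)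
          rw [Real.norm_of_nonneg hl, Real.norm_of_nonneg (hl.trans h2)]
          exact h2
        · refine le_add_left ?_
          rw [negLog, if_neg h0, ← ofReal_norm, Real.norm_of_nonpos hl]
    _ = ∫⁻ h, ‖Real.log (1 + ‖entryEval p h‖)‖ₑ ∂channelMatrixLaw nR nT +
        ∫⁻ h, negLog ‖entryEval p h‖ ∂channelMatrixLaw nR nT :=
        lintegral_add_right _ (measurable_negLog.comp hm)
    _ < ⊤ := ENNReal.add_lt_top.2 ⟨h1, lintegral_negLog_entryEval_lt_top hp⟩

end Channel

/-! ### Minors of the channel matrix as polynomials in its entries -/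

section Minor

variable {nT nR m : ℕ}

/-- The generic submatrix with rows `R` and columns `T`. -/
noncomputable def genericMinor (R : Fin m → Fin nR) (T : Fin m → Fin nT) :
    Matrix (Fin m) (Fin m) (MvPolynomial (Fin nR × Fin nT) ℂ) :=
  Matrix.of fun i j => MvPolynomial.X (R i, T j)

lemma mapMatrix_genericMinor (R : Fin m → Fin nR) (T : Fin m → Fin nT)
    (h : Fin nR → Fin nT → ℂ) :
    (MvPolynomial.eval fun q : Fin nR × Fin nT => h q.1 q.2).mapMatrix (genericMinor R T) =
      (Matrix.of h).submatrix R T := by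
  ext i j
  simp [genericMinor]

lemma entryEval_det_genericMinor (R : Fin m → Fin nR) (T : Fin m → Fin nT)
    (h : Fin nR → Fin nT → ℂ) :
    entryEval (genericMinor R T).det h = ((Matrix.of h).submatrix R T).det := by
  rw [entryEval, RingHom.map_det, mapMatrix_genericMinor]

lemma entryEval_adjugate_genericMinor (R : Fin m → Fin nR) (T : Fin m → Fin nT)
    (h : Fin nR → Fin nT → ℂ) (i j : Fin m) :
    entryEval ((genericMinor R T).adjugate i j) h = ((Matrix.of h).submatrix R T).adjugate i j := by
  rw [← mapMatrix_genericMinor, ← RingHom.map_adjugate]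
  rfl

lemma det_genericMinor_ne_zero {R : Fin m → Fin nR} {T : Fin m → Fin nT}
    (hR : Function.Injective R) (hT : Function.Injective T) : (genericMinor R T).det ≠ 0 := by
  classical
  intro h0
  -- A partial permutation matrix whose chosen submatrix is the identity.
  set h : Fin nR → Fin nT → ℂ := fun a b => if ∃ i, R i = a ∧ T i = b then 1 else 0 with hh
  have h1 := entryEval_det_genericMinor R T h
  have h2 : (Matrix.of h).submatrix R T = 1 := by
    ext i j
    simp only [Matrix.submatrix_apply, Matrix.of_apply, hh, Matrix.one_apply]
    congr 1
    rw [eq_iff_iff]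
    constructor
    · rintro ⟨l, hl1, hl2⟩
      rw [← hR hl1, hT hl2]
    · rintro rfl
      exact ⟨i, rfl, rfl⟩
  rw [h0, h2, Matrix.det_one] at h1
  simp [entryEval] at h1

lemma logIntegrable_sqFrobenius_adjugate (R : Fin m → Fin nR) (T : Fin m → Fin nT) :
    LogIntegrable fun h : Fin nR → Fin nT → ℂ =>
      sqFrobenius ((Matrix.of h).submatrix R T).adjugate := by
  simp_rw [sqFrobenius, ← entryEval_adjugate_genericMinor]
  exact LogIntegrable.sum _ fun i => LogIntegrable.sum _ fun j => logIntegrable_norm_sq_entryEval _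

lemma logIntegrable_sqFrobenius :
    LogIntegrable fun h : Fin nR → Fin nT → ℂ => sqFrobenius (Matrix.of h) := by
  simp_rw [sqFrobenius, Matrix.of_apply, sq]
  exact LogIntegrable.sum _ fun i => LogIntegrable.sum _ fun j =>
    (logIntegrable_norm_entry i j).mul (logIntegrable_norm_entry i j)

end Minor

/-! ### Columns with bounded rate and columns with logarithmic growth -/

section ColumnBounds

variable {nT nR K : ℕ}

/-- Enumerate the indices in order, jumping over the `K + 1` window positions on reaching `k`; if
`nR ≤ k` the jump never happens. -/
lemma exists_columns_avoiding_window {k : Fin nT} (hk : nR ≤ k ∨ nR + K < nT) :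
    ∃ T : Fin nR → Fin nT, Function.Injective T ∧
      ∀ v : Fin nT → ℂ, InWindow K k v → ∀ j, v (T j) = 0 := by
  have hlt : ∀ i : Fin nR, (if (i : ℕ) < k then (i : ℕ) else i + K + 1) < nT := by
    intro i
    have := i.2
    have := k.2
    split_ifs <;> omega
  refine ⟨fun i => ⟨_, hlt i⟩, fun i j hij => ?_, fun v hv j => hv _ ?_⟩
  · have := congrArg Fin.val hij
    simp only at this
    apply Fin.ext
    split_ifs at this <;> omega
  · rw [Fin.le_def]
    simp only
    split_ifs <;> omega

/-- Omit exactly the `nT - m ≤ K` indices right after `k`. They all lie in the window, so every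
index outside it is still hit. -/
lemma exists_columns_meeting_window {m : ℕ} (hm : m ≤ nT) (hK : nT ≤ m + K) {k : Fin nT}
    (hk : (k : ℕ) < m) :
    ∃ T : Fin m → Fin nT, Function.Injective T ∧ T ⟨k, hk⟩ = k ∧
      ∀ b : Fin nT, ¬ (k ≤ b ∧ (b : ℕ) ≤ k + K) → ∃ j : Fin m, j ≠ ⟨k, hk⟩ ∧ T j = b := by
  have hlt : ∀ i : Fin m, (if (i : ℕ) ≤ k then (i : ℕ) else i + (nT - m)) < nT := by
    intro i
    have := i.2
    split_ifs <;> omega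
  refine ⟨fun i => ⟨_, hlt i⟩, fun i j hij => ?_, ?_, fun b hb => ?_⟩
  · have := congrArg Fin.val hij
    simp only at this
    apply Fin.ext
    split_ifs at this <;> omega
  · simp
  · rw [Fin.le_def] at hb
    have hb2 := b.2
    by_cases h : (b : ℕ) < k
    · refine ⟨⟨b, by omega⟩, fun h2 => ?_, ?_⟩
      · have := congrArg Fin.val h2
        simp only at this
        omega
      · apply Fin.ext
        simp [h.le]
    · refine ⟨⟨b - (nT - m), by omega⟩, fun h2 => ?_, ?_⟩
      · have := congrArg Fin.val h2
        simp only at this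
        omega
      · apply Fin.ext
        simp only
        split_ifs <;> omega

lemma exists_columnRate_le_of_window_small {k : Fin nT} (hk : nR ≤ k ∨ nR + K < nT) :
    ∃ C : (Fin nR → Fin nT → ℂ) → ℝ, Integrable C (channelMatrixLaw nR nT) ∧
      ∀ᵐ h ∂channelMatrixLaw nR nT, ∀ N₀ : ℝ≥0, 0 < N₀ → ∀ v, InWindow K k v → v k ≠ 0 →
        columnRate (Matrix.of h) N₀ k v ≤ C h := by
  obtain ⟨T, hT, hwin⟩ := exists_columns_avoiding_window hk
  have hp := det_genericMinor_ne_zero (R := (id : Fin nR → Fin nR)) Function.injective_id hT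
  set p := (genericMinor (id : Fin nR → Fin nR) T).det with hpdef
  have hFa := (logIntegrable_sqFrobenius (nT := nT) (nR := nR)).mul
    (logIntegrable_sqFrobenius_adjugate (id : Fin nR → Fin nR) T)
  have hd2 := logIntegrable_norm_sq_entryEval p
  have hd := integrable_log_norm_entryEval hp
  refine ⟨fun h => Real.log 2 + (Real.log (1 + sqFrobenius (Matrix.of h) *
    sqFrobenius ((Matrix.of h).submatrix (id : Fin nR → Fin nR) T).adjugate) +
    Real.log (1 + ‖entryEval p h‖ ^ 2) - 2 * Real.log ‖entryEval p h‖),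
    (integrable_const _).add ((hFa.integrable.add hd2.integrable).sub (hd.const_mul 2)), ?_⟩
  filter_upwards [ae_entryEval_ne_zero hp] with h h0 N₀ hN v hv hvk
  have hFa0 := hFa.nonneg h
  have hdet : ((Matrix.of h).submatrix (id : Fin nR → Fin nR) T).det = entryEval p h :=
    (entryEval_det_genericMinor _ _ _).symm
  have hbound := sqNorm_le_mul_errorPower_of_minor (Matrix.of h) hN v hT (hwin v hv)
    (by rw [hdet]; exact h0)
  rw [hdet] at hbound
  set x := sqFrobenius (Matrix.of h) *
    sqFrobenius ((Matrix.of h).submatrix (id : Fin nR → Fin nR) T).adjugate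
  set d := ‖entryEval p h‖ with hddef
  have hdpos : 0 < d := norm_pos_iff.2 h0
  refine (columnRate_le_log _ hvk (by positivity) hbound).trans ?_
  rw [Real.log_mul two_ne_zero (by positivity)]
  have h2 : 1 + x / d ^ 2 ≤ (1 + x) * (1 + d ^ 2) / d ^ 2 := by
    rw [le_div_iff₀ (by positivity)]
    have : (1 + x / d ^ 2) * d ^ 2 = d ^ 2 + x := by field_simp
    rw [this]
    nlinarith [mul_nonneg hFa0 (sq_nonneg d)]
  have h3 := Real.log_le_log (by positivity) h2
  rw [Real.log_div (by positivity) (by positivity), Real.log_mul (by positivity) (by positivity),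
    Real.log_pow] at h3
  push_cast at h3
  linarith

lemma columnRate_le_log_sqFrobenius (H : Matrix (Fin nR) (Fin nT) ℂ) {N₀ : ℝ≥0} (hN : 0 < N₀)
    {k : Fin nT} {v : Fin nT → ℂ} (hvk : v k ≠ 0) :
    columnRate H N₀ k v ≤ Real.log 2 + Real.log (1 + sqFrobenius H / N₀) := by
  have hN' : (0 : ℝ) < N₀ := hN
  have hF := sqFrobenius_nonneg H
  rw [← Real.log_mul two_ne_zero (by positivity)]
  exact columnRate_le_log H hvk (by positivity) (sqNorm_le_mul_errorPower H hN v)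

/-- The unit vector at the pivot has error power at most `1`, which the summand `1` in the rate
offsets. -/
lemma exists_columnRate_nonneg (H : Matrix (Fin nR) (Fin nT) ℂ) {N₀ : ℝ≥0} (hN : 0 < N₀)
    (K : ℕ) (k : Fin nT) :
    ∃ v, InWindow K k v ∧ v k ≠ 0 ∧ 0 ≤ columnRate H N₀ k v := by
  refine ⟨Pi.single k 1, fun i hi => ?_, by simp, ?_⟩
  · have : i ≠ k := by rintro rfl; exact hi ⟨le_rfl, by omega⟩
    simp [this]
  · have h1 := errorPower_le_sqNorm H hN (Pi.single k 1)
    have h2 : sqNorm (Pi.single k 1 : Fin nT → ℂ) = 1 := by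
      rw [sqNorm, Finset.sum_eq_single k]
      · simp
      · intro i _ hi; simp [hi]
      · simp
    rw [h2] at h1
    rw [columnRate]
    simp
    linarith

lemma exists_le_columnRate_of_window_large (hK : nT ≤ nR + K) {k : Fin nT} (hk : (k : ℕ) < nR) :
    ∃ C : (Fin nR → Fin nT → ℂ) → ℝ, Integrable C (channelMatrixLaw nR nT) ∧
      ∀ᵐ h ∂channelMatrixLaw nR nT, ∀ N₀ : ℝ≥0, 0 < N₀ → ∃ v, InWindow K k v ∧ v k ≠ 0 ∧
        -Real.log N₀ - C h ≤ columnRate (Matrix.of h) N₀ k v := by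
  -- The minimum treats `nR ≥ nT` together with `nR < nT`; in the former case all columns are used.
  set m := min nR nT with hm
  have hmR : m ≤ nR := min_le_left _ _
  have hmT : m ≤ nT := min_le_right _ _
  have hkm : (k : ℕ) < m := lt_min hk k.2
  have hmK : nT ≤ m + K := by
    rcases min_choice nR nT with h | h <;> omega
  obtain ⟨T, hT, hTk, hTwin⟩ := exists_columns_meeting_window hmT hmK hkm
  set R : Fin m → Fin nR := Fin.castLE hmR with hR
  have hRinj : Function.Injective R := Fin.castLE_injective hmR
  have hp := det_genericMinor_ne_zero hRinj hT
  set p := (genericMinor R T).det with hpdef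
  -- Extension by zero from the `m` selected rows to all `nR` rows.
  set P : Matrix (Fin nR) (Fin m) ℂ := Matrix.of fun a i => if R i = a then 1 else 0 with hP
  have ha := (LogIntegrable.const (nT := nT) (nR := nR) (sqFrobenius_nonneg P)).mul
    (logIntegrable_sqFrobenius_adjugate R T)
  have hd := integrable_log_norm_entryEval hp
  refine ⟨fun h => Real.log (1 + sqFrobenius P *
    sqFrobenius ((Matrix.of h).submatrix R T).adjugate) - 2 * Real.log ‖entryEval p h‖,
    ha.integrable.sub (hd.const_mul 2), ?_⟩
  filter_upwards [ae_entryEval_ne_zero hp] with h h0 N₀ hN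
  have hN' : (0 : ℝ) < N₀ := hN
  have ha0 := ha.nonneg h
  set A := (Matrix.of h).submatrix R T with hA
  have hdet : A.det = entryEval p h := (entryEval_det_genericMinor _ _ _).symm
  set e : Fin m → ℂ := Pi.single ⟨k, hkm⟩ 1 with he
  -- On the selected columns `Hᴴ s` is then a multiple of the unit vector at `k`, hence zero outside
  -- the window. The adjugate instead of the inverse keeps `s` free of denominators; the determinant
  -- moves into the pivot.
  set s₀ : Fin m → ℂ := A.adjugateᴴ *ᵥ e with hs₀
  set s : Fin nR → ℂ := P *ᵥ s₀ with hs
  have hAs : Aᴴ *ᵥ s₀ = star A.det • e := by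
    rw [hs₀, Matrix.mulVec_mulVec, ← Matrix.conjTranspose_mul, Matrix.adjugate_mul,
      Matrix.conjTranspose_smul, Matrix.conjTranspose_one, Matrix.smul_mulVec, Matrix.one_mulVec]
  have hHs : ∀ j, ((Matrix.of h)ᴴ *ᵥ s) (T j) = star A.det * e j := by
    intro j
    have h1 : ((Matrix.of h)ᴴ *ᵥ s) (T j) = (Aᴴ *ᵥ s₀) j := by
      rw [hs, Matrix.mulVec_mulVec]
      simp only [Matrix.mulVec, dotProduct]
      refine Finset.sum_congr rfl fun i _ => ?_
      congr 1
      simp [Matrix.mul_apply, hP, hA, Matrix.conjTranspose_apply]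
    rw [h1, hAs]
    simp
  have hsle : sqNorm s ≤ sqFrobenius P * sqFrobenius A.adjugate := by
    have he1 : sqNorm e = 1 := by
      rw [sqNorm, Finset.sum_eq_single ⟨k, hkm⟩]
      · simp [he]
      · intro i _ hi; simp [he, hi]
      · simp
    have hF : sqFrobenius A.adjugateᴴ = sqFrobenius A.adjugate := by
      rw [sqFrobenius, Finset.sum_comm]
      simp [sqFrobenius, Matrix.conjTranspose_apply]
    have h1 := sqNorm_mulVec_le A.adjugateᴴ e
    rw [he1, hF, mul_one] at h1
    exact (sqNorm_mulVec_le P s₀).trans (mul_le_mul_of_nonneg_left h1 (sqFrobenius_nonneg P))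
  have hs0 := sqNorm_nonneg s
  -- Scaled so that the error power is at most `1`, while `log t²` supplies the term `-log N₀`. The
  -- added `1` avoids division by zero and matches the `log (1 + f)` form.
  set t : ℝ := √(1 / (N₀ * (1 + sqNorm s))) with ht
  have hc : 0 < (N₀ : ℝ) * (1 + sqNorm s) := by positivity
  have htpos : 0 < t := Real.sqrt_pos.2 (by positivity)
  have ht2 : ‖(t : ℂ)‖ ^ 2 = 1 / (N₀ * (1 + sqNorm s)) := by
    rw [Complex.norm_real, Real.norm_of_nonneg htpos.le, ht, Real.sq_sqrt (by positivity)]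
  set u := (Matrix.of h)ᴴ *ᵥ s with hu
  have huk : u k = star (entryEval p h) := by
    have := hHs ⟨k, hkm⟩
    rw [hTk, he, Pi.single_eq_same, mul_one, hdet] at this
    exact this
  have hdpos : 0 < ‖entryEval p h‖ := norm_pos_iff.2 h0
  refine ⟨(t : ℂ) • u, fun b hb => ?_, ?_, ?_⟩
  · obtain ⟨j, hj, rfl⟩ := hTwin b hb
    rw [Pi.smul_apply, hHs j, he, Pi.single_eq_of_ne hj, mul_zero, smul_zero]
  · rw [Pi.smul_apply, huk, smul_eq_mul]
    exact mul_ne_zero (Complex.ofReal_ne_zero.2 htpos.ne') (star_ne_zero.2 h0)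
  · have hq := errorPower_conjTranspose_mulVec_le (Matrix.of h) hN s
    have hq' : ‖(t : ℂ)‖ ^ 2 * errorPower (Matrix.of h) N₀ u ≤ 1 := by
      rw [ht2, div_mul_eq_mul_div, one_mul, div_le_one hc]
      refine hq.trans ?_
      exact mul_le_mul_of_nonneg_left (by linarith) hN'.le
    have hlog := Real.log_le_log (by positivity)
      (add_le_add_right hsle 1)
    rw [columnRate, errorPower_smul, Pi.smul_apply, huk, norm_smul, mul_pow, norm_star, ht2,
      Real.log_mul (by positivity) (by positivity), Real.log_div one_ne_zero hc.ne', Real.log_one,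
      Real.log_mul hN'.ne' (by positivity), Real.log_pow]
    rw [ht2] at hq'
    push_cast
    linarith

end ColumnBounds

/-! ### Measurability of the optimized rate -/

section Measurability

variable {nT nR K : ℕ}

lemma Receiver.continuous_gmi (r : Receiver nT nR K) (N₀ : ℝ≥0) :
    Continuous fun h : Fin nR → Fin nT → ℂ => r.gmi (Matrix.of h) N₀ := by
  by_cases hr : (1 + r.Gr).PosDef
  · simp_rw [r.gmi_eq_of_posDef hr]
    refine continuous_coe_real_ereal.comp ?_
    have hof : Continuous fun h : Fin nR → Fin nT → ℂ => (Matrix.of h : Matrix _ _ ℂ) :=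
      continuous_id
    unfold Receiver.gmiReal
    fun_prop
  · simp_rw [r.gmi_eq_bot hr]
    exact continuous_const

/-- The supremum is over an uncountable family, but a supremum of continuous functions is lower
semicontinuous. -/
lemma measurable_optimizedRate (N₀ : ℝ≥0) :
    Measurable fun h : Fin nR → Fin nT → ℂ => optimizedRate K (Matrix.of h) N₀ := by
  have h1 : LowerSemicontinuous fun h : Fin nR → Fin nT → ℂ =>
      ⨆ r : Receiver nT nR K, r.gmi (Matrix.of h) N₀ :=
    lowerSemicontinuous_iSup fun r => (r.continuous_gmi N₀).lowerSemicontinuous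
  exact h1.measurable.ereal_toReal

end Measurability

/-! ### The high-SNR slope -/

section HighSNR

variable {nT nR K : ℕ}

lemma noiseDensity_pos (hT : 0 < nT) {snr : ℝ} (hsnr : 0 < snr) : 0 < noiseDensity nT snr := by
  rw [noiseDensity, Real.toNNReal_pos]
  positivity

lemma coe_noiseDensity {snr : ℝ} (hsnr : 0 < snr) :
    ((noiseDensity nT snr : ℝ≥0) : ℝ) = nT / snr :=
  Real.coe_toNNReal _ (by positivity)

lemma optimizedRate_nonneg (H : Matrix (Fin nR) (Fin nT) ℂ) {N₀ : ℝ≥0} (hN : 0 < N₀) :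
    0 ≤ optimizedRate K H N₀ := by
  simpa using le_optimizedRate (K := K) H hN (c := fun _ => 0)
    fun k => exists_columnRate_nonneg H hN K k

lemma integrable_optimizedRate {N₀ : ℝ≥0} (hN : 0 < N₀) :
    Integrable (fun h : Fin nR → Fin nT → ℂ => optimizedRate K (Matrix.of h) N₀)
      (channelMatrixLaw nR nT) := by
  have hN' : (0 : ℝ) < N₀ := hN
  have hF : LogIntegrable fun h : Fin nR → Fin nT → ℂ => sqFrobenius (Matrix.of h) * (N₀ : ℝ)⁻¹ :=
    logIntegrable_sqFrobenius.mul (LogIntegrable.const (by positivity))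
  refine Integrable.mono' (g := fun h => ∑ _k : Fin nT,
    (Real.log 2 + Real.log (1 + sqFrobenius (Matrix.of h) * (N₀ : ℝ)⁻¹)))
    (integrable_finsetSum _ fun _ _ => (integrable_const _).add hF.integrable)
    (measurable_optimizedRate N₀).aestronglyMeasurable (ae_of_all _ fun h => ?_)
  rw [Real.norm_of_nonneg (optimizedRate_nonneg _ hN)]
  exact optimizedRate_le _ hN fun k v _ hvk => columnRate_le_log_sqFrobenius _ hN hvk

/-- The high-SNR slope of the largest column rate with pivot `k`. -/
def growth (nT nR K : ℕ) (k : Fin nT) : ℝ := if (k : ℕ) < nR ∧ nT ≤ nR + K then 1 else 0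

lemma sum_growth (nT nR K : ℕ) :
    ∑ k, growth nT nR K k =
      if nT ≤ nR then (nT : ℝ) else if nT ≤ nR + K then (nR : ℝ) else 0 := by
  simp only [growth]
  split_ifs with h1 h2
  · have : ∀ k : Fin nT, ((k : ℕ) < nR ∧ nT ≤ nR + K) := fun k => ⟨by omega, by omega⟩
    rw [Finset.sum_congr rfl fun k _ => if_pos (this k)]
    simp
  · simp only [h2, and_true]
    rw [Finset.sum_ite]
    simp only [Finset.sum_const, smul_zero, add_zero, nsmul_eq_mul, mul_one, Nat.cast_inj]
    rw [Fin.card_filter_val_lt]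
    omega
  · simp [h2]

/-- One integrable `C`, and one null set, serve all `snr ≥ 1`; this uniformity lets the expectation
be taken before the limit. -/
lemma exists_columnRate_growth (hT : 0 < nT) (k : Fin nT) :
    ∃ C : (Fin nR → Fin nT → ℂ) → ℝ, Integrable C (channelMatrixLaw nR nT) ∧
      ∀ᵐ h ∂channelMatrixLaw nR nT, ∀ snr : ℝ, 1 ≤ snr →
        (∀ v, InWindow K k v → v k ≠ 0 →
          columnRate (Matrix.of h) (noiseDensity nT snr) k v ≤
            growth nT nR K k * Real.log snr + C h) ∧
        ∃ v, InWindow K k v ∧ v k ≠ 0 ∧ growth nT nR K k * Real.log snr - C h ≤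
          columnRate (Matrix.of h) (noiseDensity nT snr) k v := by
  by_cases hk : (k : ℕ) < nR ∧ nT ≤ nR + K
  · obtain ⟨C, hC, hle⟩ := exists_le_columnRate_of_window_large hk.2 hk.1
    have hF := (logIntegrable_sqFrobenius (nT := nT) (nR := nR)).integrable
    have hT' : (0 : ℝ) < nT := by exact_mod_cast hT
    have hT1 : (1 : ℝ) ≤ nT := by exact_mod_cast hT
    refine ⟨fun h => |C h| + (Real.log 2 + Real.log (1 + sqFrobenius (Matrix.of h)) +
      Real.log nT), hC.abs.add (((integrable_const _).add hF).add (integrable_const _)), ?_⟩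
    filter_upwards [hle] with h hh snr hsnr
    have hsnr0 : 0 < snr := by linarith
    have hN := noiseDensity_pos hT hsnr0
    have hg : growth nT nR K k = 1 := if_pos hk
    have hF0 := sqFrobenius_nonneg (Matrix.of h)
    have hlogT : 0 ≤ Real.log nT := Real.log_nonneg hT1
    have hlogF : 0 ≤ Real.log (1 + sqFrobenius (Matrix.of h)) := Real.log_nonneg (by linarith)
    have hlog2 : 0 ≤ Real.log 2 := Real.log_nonneg (by norm_num)
    rw [hg, one_mul]
    constructor
    · intro v _ hvk
      refine (columnRate_le_log_sqFrobenius _ hN hvk).trans ?_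
      rw [coe_noiseDensity hsnr0]
      have h1 : 1 + sqFrobenius (Matrix.of h) / (nT / snr) ≤
          snr * (1 + sqFrobenius (Matrix.of h)) := by
        have : sqFrobenius (Matrix.of h) / (nT / snr) ≤ snr * sqFrobenius (Matrix.of h) := by
          rw [div_div_eq_mul_div, div_le_iff₀ hT', mul_comm snr]
          exact le_mul_of_one_le_right (by positivity) hT1
        linarith
      have h2 := Real.log_le_log (by positivity) h1
      rw [Real.log_mul hsnr0.ne' (by positivity)] at h2
      linarith [abs_nonneg (C h)]
    · obtain ⟨v, hv, hvk, hle⟩ := hh _ hN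
      refine ⟨v, hv, hvk, le_trans ?_ hle⟩
      rw [coe_noiseDensity hsnr0, Real.log_div hT'.ne' hsnr0.ne']
      linarith [le_abs_self (C h)]
  · have hk' : nR ≤ k ∨ nR + K < nT := by
      rw [not_and_or] at hk
      omega
    obtain ⟨C, hC, hle⟩ := exists_columnRate_le_of_window_small (nT := nT) (nR := nR) hk'
    refine ⟨fun h => |C h|, hC.abs, ?_⟩
    filter_upwards [hle] with h hh snr hsnr
    have hN := noiseDensity_pos hT (by linarith : 0 < snr)
    have hg : growth nT nR K k = 0 := if_neg hk
    rw [hg, zero_mul, zero_add, zero_sub]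
    refine ⟨fun v hv hvk => (hh _ hN v hv hvk).trans (le_abs_self _), ?_⟩
    obtain ⟨v, hv, hvk, h0⟩ := exists_columnRate_nonneg (Matrix.of h) hN K k
    exact ⟨v, hv, hvk, le_trans (neg_nonpos.2 (abs_nonneg _)) h0⟩

/-- Summing the two-sided column bounds and integrating gives an error bounded in `snr`, which
vanishes after division by `log snr`. -/
lemma exists_abs_ergodicRate_sub_le (hT : 0 < nT) (nR K : ℕ) :
    ∃ D : ℝ, ∀ snr : ℝ, 1 ≤ snr →
      |ergodicRate nT nR K snr - (∑ k, growth nT nR K k) * Real.log snr| ≤ D := by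
  choose C hC hbound using fun k : Fin nT =>
    exists_columnRate_growth (nT := nT) (nR := nR) (K := K) hT k
  refine ⟨∫ h, ∑ k, C k h ∂channelMatrixLaw nR nT, fun snr hsnr => ?_⟩
  have hN := noiseDensity_pos hT (by linarith : 0 < snr)
  have hint : Integrable (fun h => ∑ k, C k h) (channelMatrixLaw nR nT) :=
    integrable_finsetSum _ fun k _ => hC k
  have hrate := integrable_optimizedRate (nT := nT) (nR := nR) (K := K) hN
  set g := (∑ k, growth nT nR K k) * Real.log snr with hg
  have hae : ∀ᵐ h ∂channelMatrixLaw nR nT,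
      |optimizedRate K (Matrix.of h) (noiseDensity nT snr) - g| ≤ ∑ k, C k h := by
    filter_upwards [ae_all_iff.2 hbound] with h hh
    rw [abs_le]
    constructor
    · have := le_optimizedRate (K := K) (Matrix.of h) hN
        (c := fun k => growth nT nR K k * Real.log snr - C k h) fun k => (hh k snr hsnr).2
      rw [Finset.sum_sub_distrib, ← Finset.sum_mul, ← hg] at this
      linarith
    · have := optimizedRate_le (K := K) (Matrix.of h) hN
        (c := fun k => growth nT nR K k * Real.log snr + C k h) fun k => (hh k snr hsnr).1
      rw [Finset.sum_add_distrib, ← Finset.sum_mul, ← hg] at this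
      linarith
  have heq : ergodicRate nT nR K snr - g =
      ∫ h, (optimizedRate K (Matrix.of h) (noiseDensity nT snr) - g) ∂channelMatrixLaw nR nT := by
    rw [integral_sub hrate (integrable_const _), ergodicRate]
    simp
  rw [heq]
  exact norm_integral_le_of_norm_le (f := fun h : Fin nR → Fin nT → ℂ =>
    optimizedRate K (Matrix.of h) (noiseDensity nT snr) - g) hint hae

lemma tendsto_ergodicRate_div_log (hT : 0 < nT) (nR K : ℕ) :
    Tendsto (fun snr : ℝ => ergodicRate nT nR K snr / Real.log snr) atTop
      (𝓝 (∑ k, growth nT nR K k)) := by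
  obtain ⟨D, hD⟩ := exists_abs_ergodicRate_sub_le hT nR K
  rw [tendsto_iff_norm_sub_tendsto_zero]
  have hlim : Tendsto (fun snr : ℝ => D / Real.log snr) atTop (𝓝 0) :=
    Real.tendsto_log_atTop.const_div_atTop D
  refine squeeze_zero' (Eventually.of_forall fun _ => norm_nonneg _) ?_ hlim
  filter_upwards [eventually_gt_atTop 1] with snr hsnr
  have hlog : 0 < Real.log snr := Real.log_pos hsnr
  have : ergodicRate nT nR K snr / Real.log snr - ∑ k, growth nT nR K k =
      (ergodicRate nT nR K snr - (∑ k, growth nT nR K k) * Real.log snr) / Real.log snr := by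
    field_simp
  rw [this, Real.norm_eq_abs, abs_div, abs_of_pos hlog]
  exact div_le_div_of_nonneg_right (hD snr hsnr.le) hlog.le

end HighSNR

end ChannelShortening

/-- For every signal-to-noise ratio and every channel matrix, the optimized rate is the (finite,
attained) maximum of the generalized mutual information over all receivers of memory `K`; it is
integrable over the channel; and its mean has the stated high-SNR slope. -/
theorem mainTheorem7 (nT nR K : ℕ) (hT : 0 < nT) (hR : 0 < nR) :
    (∀ snr : ℝ, 0 < snr →
      (∀ H : Matrix (Fin nR) (Fin nT) ℂ,
        IsGreatest
          (Set.range fun r : ChannelShortening.Receiver nT nR K =>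
            r.gmi H (ChannelShortening.noiseDensity nT snr))
          ((ChannelShortening.optimizedRate K H
            (ChannelShortening.noiseDensity nT snr) : ℝ) : EReal)) ∧
      Integrable
        (fun h : Fin nR → Fin nT → ℂ =>
          ChannelShortening.optimizedRate K (Matrix.of h)
            (ChannelShortening.noiseDensity nT snr))
        (ChannelShortening.channelMatrixLaw nR nT)) ∧
    Tendsto (fun snr : ℝ => ChannelShortening.ergodicRate nT nR K snr / Real.log snr) atTop
      (𝓝 (if nT ≤ nR then (nT : ℝ) else if nT ≤ nR + K then (nR : ℝ) else 0)) := by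
  refine ⟨fun snr hsnr => ?_, ?_⟩
  · have hN := ChannelShortening.noiseDensity_pos hT hsnr
    exact ⟨fun H => ChannelShortening.isGreatest_optimizedRate H K hN,
      ChannelShortening.integrable_optimizedRate hN⟩
  · rw [← ChannelShortening.sum_growth]
    exact ChannelShortening.tendsto_ergodicRate_div_log hT nR K
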